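/- An effect algebra is a set $E$ with constants $0,1$, a unary operation ${}'$ and a partial binary operation $\oplus$ that is commutative and associative (if one side is defined, so is the other and they agree), such that $a\oplus b=1$ iff $b=a'$, and $a\oplus 1$ is defined iff $a=0$, in which case $0\oplus 1=1$. A homomorphism $f$ satisfies $f(a\oplus b)=f(a)\oplus f(b)$ whenever $a\oplus b$ is defined, and $f(1)=1$. Let $\mathbf{EA}$ be the resulting category. It is a monoidal category: the unit is the two-element effect algebra $\mathbf 2=\{0,1\}$, and $E\otimes F$ is the effect algebra with a universal bihomomorphism $E\times F\to E\otimes F$, $(x,y)\mapsto x\otimes y$, where a bihomomorphism $\beta$ preserves existing orthosums in each variable separately and satisfies $\beta(1,1)=1$. Let $\mathbf{POG}_u$ be the category of pairs $(A,u)$ of a partially ordered Abelian group $A$ and an order unit $u$ ($u\ge 0$, and for each $x\in A$ there is $n\in\mathbb N$ with $x\le n u$), with positive group homomorphisms that preserve the order unit as morphisms. It is a monoidal category: the unit is $(\mathbb Z,1)$, and $(A,u)\otimes(B,v)=(A\otimes_{\mathbb Z}B,\,u\otimes v)$ with positive cone the set of all finite sums $\sum_i a_i\otimes b_i$ with $a_i\ge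 0$ and $b_i\ge 0$. In both categories the associator and the unitors are the canonical ones. Let $\Gamma\colon\mathbf{POG}_u\to\mathbf{EA}$ be the functor sending $(A,u)$ to the interval $\{a\in A\mid 0\le a\le u\}$ with $a\oplus b=a+b$ defined iff $a+b\le u$. Let $\mathrm{Gr}\colon\mathbf{EA}\to\mathbf{POG}_u$ be its left adjoint, sending $E$ to its universal group; write $[x]\in\mathrm{Gr}(E)$ for the image of $x\in E$ under the unit $E\to\Gamma(\mathrm{Gr}(E))$. **Theorem.** The functor $\mathrm{Gr}\colon\mathbf{EA}\to\mathbf{POG}_u$ is strong monoidal. More precisely, there are an isomorphism $\varepsilon\colon(\mathbb Z,1)\to\mathrm{Gr}(\mathbf 2)$ and an isomorphism $\mu_{E,F}\colon\mathrm{Gr}(E)\otimes\mathrm{Gr}(F)\to\mathrm{Gr}(E\otimes F)$, natural in the effect algebras $E$ and $F$, that satisfy the associativity and unit coherence conditions of a monoidal functor; moreover, $\varepsilon$ is the unique morphism $(\mathbb Z,1)\to\mathrm{Gr}(\mathbf 2)$ in $\mathbf{POG}_u$, and $\mu_{E,F}([x]\otimes[y])=[x\otimes y]$ for all $x\in E$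 and $y\in F$. -/

import Mathlib

universe u
open scoped TensorProduct

theorem exists_pos_perturb {n : ℕ} (p q : Fin n → ℚ) (hp : ∀ i, 0 < p i) :
    ∃ e : ℚ, 0 < e ∧ ∀ i, 0 < p i + e * q i := by
  have h : ∀ᶠ e in nhdsWithin (0 : ℚ) (Set.Ioi 0), ∀ i, 0 < p i + e * q i := by
    rw [Filter.eventually_all]
    intro i
    have hc : Continuous fun e : ℚ => p i + e * q i := by fun_prop
    have : ∀ᶠ e in nhds (0 : ℚ), 0 < p i + e * q i :=
      hc.continuousAt.eventually (lt_mem_nhds (by simpa using hp i))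
    exact this.filter_mono nhdsWithin_le_nhds
  obtain ⟨e, h1, h2⟩ := (h.and self_mem_nhdsWithin).exists
  exact ⟨e, h2, h1⟩

theorem exists_dual_pos {V : Type u} [AddCommGroup V] [Module ℚ V] (n : ℕ) :
    ∀ a : Fin n → V,
      (∀ c : Fin n → ℚ, (∀ i, 0 ≤ c i) → ∑ i, c i • a i = 0 → ∀ i, c i = 0) →
      ∃ f : V →ₗ[ℚ] ℚ, ∀ i, 0 < f (a i) := by
  induction n with
  | zero => exact fun a _ => ⟨0, fun i => i.elim0⟩
  | succ n ih =>
    intro a ha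
    obtain ⟨f, hf⟩ := ih (fun i => a i.succ) (fun c hc h i => by
      have := ha (Fin.cons 0 c) (fun i => by
        refine Fin.cases ?_ (fun j => ?_) i
        · simp
        · simpa using hc j) (by simpa [Fin.sum_univ_succ] using h) i.succ
      simpa using this)
    rcases lt_trichotomy (f (a 0)) 0 with h0 | h0 | h0
    · -- eliminate `a 0`
      set t : Fin n → ℚ := fun i => -f (a i.succ) / f (a 0) with ht
      have htpos : ∀ i, 0 < t i := fun i => div_pos_of_neg_of_neg (by have := hf i; linarith) h0
      obtain ⟨g, hg⟩ := ih (fun i => a i.succ + t i • a 0) (fun c hc h i => by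
        have := ha (Fin.cons (∑ i, c i * t i) c) (fun i => by
          refine Fin.cases ?_ (fun j => ?_) i
          · simpa using Finset.sum_nonneg fun j _ => mul_nonneg (hc j) (htpos j).le
          · simpa using hc j) (by
            rw [← h]
            simp only [Fin.sum_univ_succ, Fin.cons_zero, Fin.cons_succ, smul_add,
              Finset.sum_add_distrib, Finset.sum_smul, smul_smul]
            rw [add_comm]) i.succ
        simpa using this)
      have hg' : ∀ i, 0 < g (a i.succ) + t i * g (a 0) := fun i => by simpa using hg i
      set l : ℚ := -g (a 0) / f (a 0) with hl
      obtain ⟨e, he, hp⟩ := exists_pos_perturb (fun i => g (a i.succ) + t i * g (a 0))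
        (fun i => -f (a i.succ)) hg'
      refine ⟨g + (l - e) • f, fun i => Fin.cases ?_ (fun j => ?_) i⟩
      · have : l * f (a 0) = -g (a 0) := by rw [hl]; exact div_mul_cancel₀ _ h0.ne
        simp only [LinearMap.add_apply, LinearMap.smul_apply, smul_eq_mul]
        nlinarith
      · have h1 := hp j
        have : l * f (a j.succ) = t j * g (a 0) := by
          simp only [hl, ht]; field_simp
        simp only [LinearMap.add_apply, LinearMap.smul_apply, smul_eq_mul]
        nlinarith
    · have hne : a 0 ≠ 0 := fun h => by
        have := ha (Fin.cons 1 0) (fun i => by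
          refine Fin.cases ?_ (fun j => ?_) i <;> simp) (by simp [Fin.sum_univ_succ, h]) 0
        simp at this
      obtain ⟨g, hg⟩ : ∃ g : V →ₗ[ℚ] ℚ, g (a 0) = 1 := by
        obtain ⟨g, hg⟩ := Module.exists_dual_forall_apply_ne_zero (K := ℚ) (fun _ : Unit => a 0)
          (fun _ => hne)
        exact ⟨(g (a 0))⁻¹ • g, by simpa using inv_mul_cancel₀ (hg ())⟩
      obtain ⟨e, he, hp⟩ := exists_pos_perturb (fun i => f (a i.succ)) (fun i => g (a i.succ)) hf
      refine ⟨f + e • g, fun i => Fin.cases ?_ (fun j => ?_) i⟩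
      · simpa [h0, hg] using he
      · simpa using hp j
    · exact ⟨f, fun i => Fin.cases h0 hf i⟩

theorem exists_addMonoidHom_pos {A : Type u} [AddCommGroup A] [PartialOrder A]
    [IsOrderedAddMonoid A] {n : ℕ} (a : Fin n → A) (ha : ∀ i, 0 < a i) :
    ∃ f : A →+ ℚ, ∀ i, 0 < f (a i) := by
  let j : A →ₗ[ℤ] ℚ ⊗[ℤ] A := TensorProduct.mk ℤ ℚ A 1
  obtain ⟨f, hf⟩ := exists_dual_pos n (fun i => j (a i)) (fun c hc h => by
    obtain ⟨N, hN⟩ := IsLocalization.exist_integer_multiples_of_finite (nonZeroDivisors ℤ) c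
    have hN0 : (N : ℤ) ≠ 0 := nonZeroDivisors.ne_zero N.2
    choose m hm using hN
    have hm' : ∀ i, (m i : ℚ) = (N : ℤ) * c i := fun i => by
      have := hm i
      simpa using this
    have h1 : j (∑ i, m i • a i) = 0 := by
      have : (N : ℤ) • (∑ i, c i • j (a i)) = 0 := by rw [h, smul_zero]
      rw [← this, map_sum, Finset.smul_sum]
      refine Finset.sum_congr rfl fun i _ => ?_
      rw [map_zsmul, ← Int.cast_smul_eq_zsmul ℚ (m i), hm', mul_smul, Int.cast_smul_eq_zsmul]
    have hloc : IsLocalizedModule (nonZeroDivisors ℤ) j :=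
      IsLocalization.tensorProduct_isLocalizedModule (nonZeroDivisors ℤ) ℚ
    obtain ⟨s, hs⟩ := (IsLocalizedModule.eq_zero_iff (nonZeroDivisors ℤ) j).1 h1
    have hs0 : (s : ℤ) ≠ 0 := nonZeroDivisors.ne_zero s.2
    have h2 : ∑ i, (s * s * (N * m i) : ℤ) • a i = 0 := by
      have : (s * N : ℤ) • (s • ∑ i, m i • a i) = 0 := by rw [hs, smul_zero]
      rw [← this, Submonoid.smul_def, smul_smul, Finset.smul_sum]
      refine Finset.sum_congr rfl fun i _ => ?_
      rw [smul_smul]; congr 1; ring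
    have hk : ∀ i, 0 ≤ (s * s * (N * m i) : ℤ) := fun i => by
      have : (0 : ℚ) ≤ ((N : ℤ) : ℚ) * m i := by
        rw [hm', ← mul_assoc]; exact mul_nonneg (mul_self_nonneg _) (hc i)
      exact mul_nonneg (mul_self_nonneg _) (by exact_mod_cast this)
    intro i
    have h3 := (Finset.sum_eq_zero_iff_of_nonneg
      (fun i _ => zsmul_nonneg (ha i).le (hk i))).1 h2 i (Finset.mem_univ i)
    have h4 : (s * s * (N * m i) : ℤ) = 0 := by
      by_contra hne
      exact (zsmul_pos (ha i) (lt_of_le_of_ne (hk i) (Ne.symm hne))).ne' h3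
    have h5 : m i = 0 := by simpa [hs0, hN0] using h4
    have h6 := hm' i
    rw [h5] at h6
    have h7 : ((N : ℤ) : ℚ) ≠ 0 := by exact_mod_cast hN0
    simpa [h7] using h6.symm)
  exact ⟨(f.toAddMonoidHom).comp j.toAddMonoidHom, hf⟩

/-- The positive cone of the tensor product of two partially ordered Abelian groups: all finite
sums of tensors `a ⊗ b` with `0 ≤ a` and `0 ≤ b`. -/
def tensorCone (A B : Type u) [AddCommGroup A] [PartialOrder A] [AddCommGroup B]
    [PartialOrder B] : AddSubmonoid (A ⊗[ℤ] B) :=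
  AddSubmonoid.closure {t | ∃ a : A, ∃ b : B, 0 ≤ a ∧ 0 ≤ b ∧ t = a ⊗ₜ[ℤ] b}

theorem tensorCone_strict {A B : Type u} [AddCommGroup A] [PartialOrder A] [IsOrderedAddMonoid A]
    [AddCommGroup B] [PartialOrder B] [IsOrderedAddMonoid B] {z : A ⊗[ℤ] B}
    (h1 : z ∈ tensorCone A B) (h2 : -z ∈ tensorCone A B) : z = 0 := by
  obtain ⟨l, hl, rfl⟩ := AddSubmonoid.exists_list_of_mem_closure h1
  obtain ⟨l', hl', hs⟩ := AddSubmonoid.exists_list_of_mem_closure h2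
  have key : ∀ L : List (A ⊗[ℤ] B), (∀ t ∈ L, ∃ a : A, ∃ b : B, 0 < a ∧ 0 < b ∧ t = a ⊗ₜ[ℤ] b) →
      L.sum = 0 → L = [] := by
    intro L hL hsum
    choose a b ha hb hab using fun i : Fin L.length => hL (L.get i) (L.get_mem i)
    obtain ⟨f, hf⟩ := exists_addMonoidHom_pos a ha
    obtain ⟨g, hg⟩ := exists_addMonoidHom_pos b hb
    let F : A ⊗[ℤ] B →ₗ[ℤ] ℚ :=
      TensorProduct.lift ((LinearMap.mul ℤ ℚ).compl₁₂ f.toIntLinearMap g.toIntLinearMap)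
    have hF : ∀ i, F (L.get i) = f (a i) * g (b i) := fun i => by rw [hab]; rfl
    have h0 : ∑ i, f (a i) * g (b i) = 0 := by
      have : F L.sum = 0 := by rw [hsum, map_zero]
      rw [← this, ← List.sum_ofFn , map_list_sum]
      congr 1
      conv_rhs => rw [← List.ofFn_get L, List.map_ofFn]
      congr 1
      funext i
      simp only [Function.comp, hF]
    by_contra hne
    have hlen : 0 < L.length := List.length_pos_iff.2 hne
    have : 0 < ∑ i, f (a i) * g (b i) :=
      Finset.sum_pos (fun i _ => mul_pos (hf i) (hg i)) ⟨⟨0, hlen⟩, Finset.mem_univ _⟩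
    exact this.ne' h0
  classical
  have hfil : ∀ L : List (A ⊗[ℤ] B), (L.filter (· ≠ 0)).sum = L.sum := by
    intro L
    induction L with
    | nil => rfl
    | cons t L ih =>
      by_cases ht : t = 0
      · simp [ht] at ih ⊢; exact ih
      · simp [ht] at ih ⊢; exact ih
  have hnil := key ((l ++ l').filter (· ≠ 0)) (fun t ht => by
    rw [List.mem_filter, List.mem_append] at ht
    obtain ⟨a, b, ha, hb, rfl⟩ : ∃ a : A, ∃ b : B, 0 ≤ a ∧ 0 ≤ b ∧ t = a ⊗ₜ[ℤ] b :=
      ht.1.elim (hl t) (hl' t)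
    have hne : a ⊗ₜ[ℤ] b ≠ 0 := by simpa using ht.2
    refine ⟨a, b, lt_of_le_of_ne ha ?_, lt_of_le_of_ne hb ?_, rfl⟩
    · rintro rfl; exact hne (TensorProduct.zero_tmul _ _)
    · rintro rfl; exact hne (TensorProduct.tmul_zero _ _))
    (by rw [hfil, List.sum_append, hs, add_neg_cancel])
  rw [List.filter_append, List.append_eq_nil_iff] at hnil
  rw [← hfil, hnil.1, List.sum_nil]

open CategoryTheory

/-- An object of `POG_u`: a partially ordered Abelian group with a distinguished order unit. -/
structure POGu : Type (u + 1) where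
  carrier : Type u
  [group : AddCommGroup carrier]
  [order : PartialOrder carrier]
  [ordered : IsOrderedAddMonoid carrier]
  unit : carrier
  unit_nonneg : 0 ≤ unit
  exists_le_nsmul : ∀ x : carrier, ∃ n : ℕ, x ≤ n • unit

namespace POGu

instance : CoeSort POGu.{u} (Type u) := ⟨POGu.carrier⟩

attribute [instance] POGu.group POGu.order POGu.ordered

/-- Morphisms of `POG_u`: positive group homomorphisms that preserve the order unit. -/
@[ext]
structure Hom (A B : POGu.{u}) : Type u where
  toAddMonoidHom : A →+ B
  map_nonneg' : ∀ x : A, 0 ≤ x → 0 ≤ toAddMonoidHom x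
  map_unit' : toAddMonoidHom A.unit = B.unit

instance (A B : POGu.{u}) : FunLike (Hom A B) A B where
  coe f := f.toAddMonoidHom
  coe_injective _ _ h := Hom.ext (DFunLike.coe_injective h)

instance (A B : POGu.{u}) : AddMonoidHomClass (Hom A B) A B where
  map_add f := f.toAddMonoidHom.map_add
  map_zero f := f.toAddMonoidHom.map_zero

instance : Category POGu.{u} where
  Hom A B := Hom A B
  id A := ⟨AddMonoidHom.id A, fun _ h => h, rfl⟩
  comp f g := ⟨g.toAddMonoidHom.comp f.toAddMonoidHom,
    fun x h => g.map_nonneg' _ (f.map_nonneg' x h),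
    (congrArg g.toAddMonoidHom f.map_unit').trans g.map_unit'⟩

instance : ConcreteCategory POGu.{u} Hom where
  hom f := f
  ofHom f := f
  id_apply _ := rfl
  comp_apply _ _ _ := rfl

theorem map_nonneg {A B : POGu.{u}} (f : A ⟶ B) {x : A} (h : 0 ≤ x) : 0 ≤ f x :=
  Hom.map_nonneg' f x h

theorem map_unit {A B : POGu.{u}} (f : A ⟶ B) : f A.unit = B.unit := Hom.map_unit' f

theorem hom_ext {A B : POGu.{u}} {f g : A ⟶ B} (h : ∀ x : A, f x = g x) : f = g :=
  DFunLike.ext (F := Hom A B) f g h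

/-- The po-group `A ⊗ B`: the tensor product of Abelian groups, ordered by the cone of all sums
of tensors of positive elements, with order unit `u ⊗ v`. -/
def tensor (A B : POGu.{u}) : POGu.{u} :=
  letI C : AddGroupCone (A ⊗[ℤ] B) :=
    { tensorCone A B with eq_zero_of_mem_of_neg_mem' := tensorCone_strict }
  letI : PartialOrder (A ⊗[ℤ] B) := PartialOrder.mkOfAddGroupCone C
  haveI : IsOrderedAddMonoid (A ⊗[ℤ] B) := IsOrderedAddMonoid.mkOfCone C
  have hpos : ∀ (a : A) (b : B), 0 ≤ a → 0 ≤ b → 0 ≤ a ⊗ₜ[ℤ] b := fun a b ha hb => by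
    change a ⊗ₜ[ℤ] b - 0 ∈ tensorCone A B
    rw [sub_zero]
    exact AddSubmonoid.subset_closure ⟨a, b, ha, hb, rfl⟩
  { carrier := A ⊗[ℤ] B
    unit := A.unit ⊗ₜ[ℤ] B.unit
    unit_nonneg := hpos _ _ A.unit_nonneg B.unit_nonneg
    exists_le_nsmul := fun x => by
      induction x using TensorProduct.induction_on with
      | zero => exact ⟨0, by simp⟩
      | tmul a b =>
        obtain ⟨n, hn⟩ := A.exists_le_nsmul a
        obtain ⟨n', hn'⟩ := A.exists_le_nsmul (-a)
        obtain ⟨m, hm⟩ := B.exists_le_nsmul b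
        obtain ⟨m', hm'⟩ := B.exists_le_nsmul (-b)
        refine ⟨n * m + n' * m + n' * m', ?_⟩
        have h1 := hpos (n • A.unit - a) (m • B.unit) (sub_nonneg.2 hn)
          (nsmul_nonneg B.unit_nonneg m)
        have h2 := hpos (n' • A.unit - -a) (m • B.unit - b) (sub_nonneg.2 hn') (sub_nonneg.2 hm)
        have h3 := hpos (n' • A.unit) (m' • B.unit - -b) (nsmul_nonneg A.unit_nonneg n')
          (sub_nonneg.2 hm')
        rw [← sub_nonneg]
        refine (add_nonneg (add_nonneg h1 h2) h3).trans_eq ?_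
        simp only [TensorProduct.sub_tmul,
          TensorProduct.tmul_sub, TensorProduct.neg_tmul, TensorProduct.tmul_neg,
          ← natCast_zsmul, ← TensorProduct.smul_tmul', TensorProduct.tmul_smul]
        push_cast
        module
      | add x y hx hy =>
        obtain ⟨n, hn⟩ := hx
        obtain ⟨m, hm⟩ := hy
        exact ⟨n + m, by rw [add_smul]; exact add_le_add hn hm⟩ }

/-- The simple tensor `a ⊗ b` as an element of `A ⊗ B`. -/
def tmul {A B : POGu.{u}} (a : A) (b : B) : tensor A B := a ⊗ₜ[ℤ] b

/-- Bihomomorphisms of unital Abelian po-groups. -/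
structure IsBihom {A B C : POGu.{u}} (β : A → B → C) : Prop where
  add_left : ∀ a a' b, β (a + a') b = β a b + β a' b
  add_right : ∀ a b b', β a (b + b') = β a b + β a b'
  nonneg : ∀ a b, 0 ≤ a → 0 ≤ b → 0 ≤ β a b
  map_unit : β A.unit B.unit = C.unit

theorem tensor_nonneg_iff {A B : POGu.{u}} (z : A ⊗[ℤ] B) :
    @LE.le (tensor A B) _ 0 z ↔ z ∈ tensorCone A B :=
  iff_of_eq (congrArg (· ∈ tensorCone A B) (sub_zero z))

theorem tmul_isBihom (A B : POGu.{u}) : IsBihom (C := tensor A B) (tmul (A := A) (B := B)) where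
  add_left := TensorProduct.add_tmul
  add_right := TensorProduct.tmul_add
  nonneg a b ha hb := (tensor_nonneg_iff _).2 (AddSubmonoid.subset_closure ⟨a, b, ha, hb, rfl⟩)
  map_unit := rfl

theorem nonneg_induction {A B : POGu.{u}} {P : tensor A B → Prop}
    (h : ∀ a b, 0 ≤ a → 0 ≤ b → P (tmul a b)) (h0 : P 0) (hadd : ∀ x y, P x → P y → P (x + y))
    {x : tensor A B} (hx : 0 ≤ x) : P x := by
  refine AddSubmonoid.closure_induction (motive := fun x _ => P x) ?_ h0
    (fun x y _ _ => hadd x y) ((tensor_nonneg_iff _).1 hx)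
  rintro _ ⟨a, b, ha, hb, rfl⟩
  exact h a b ha hb

/-- The group homomorphism out of the tensor product induced by a biadditive map. -/
def liftAdd {A B : POGu.{u}} {M : Type u} [AddCommGroup M] (b : A →+ B →+ M) : tensor A B →+ M :=
  TensorProduct.liftAddHom (R := ℤ) (M := A) (N := B) b (fun r x y => by
    rw [map_zsmul, map_zsmul]; rfl)

@[simp]
theorem liftAdd_tmul {A B : POGu.{u}} {M : Type u} [AddCommGroup M] (f : A →+ B →+ M)
    (a : A) (b : B) : liftAdd f (tmul a b) = f a b := rfl

/-- A group homomorphism out of the tensor product that is positive on simple tensors of positive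
elements and preserves the unit is a morphism. -/
def ofAdd {A B C : POGu.{u}} (f : tensor A B →+ C)
    (h : ∀ a b, 0 ≤ a → 0 ≤ b → 0 ≤ f (tmul a b)) (hu : f (tmul A.unit B.unit) = C.unit) :
    tensor A B ⟶ C :=
  show Hom (tensor A B) C from
  { toAddMonoidHom := f
    map_nonneg' := fun _ hx => nonneg_induction (P := fun x => 0 ≤ f x) h (by rw [map_zero])
      (fun x y hx hy => by rw [map_add]; exact add_nonneg hx hy) hx
    map_unit' := hu }

/-- The morphism out of the tensor product induced by a bihomomorphism. -/
def lift {A B C : POGu.{u}} (β : A → B → C) (h : IsBihom β) : tensor A B ⟶ C :=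
  ofAdd (liftAdd (AddMonoidHom.mk' (fun a => AddMonoidHom.mk' (β a) (h.add_right a))
    (fun a a' => by ext b; exact h.add_left a a' b))) h.nonneg h.map_unit

@[simp]
theorem lift_tmul {A B C : POGu.{u}} (β : A → B → C) (h : IsBihom β) (a : A) (b : B) :
    lift β h (tmul a b) = β a b := rfl

theorem addHom_ext {A B : POGu.{u}} {M : Type u} [AddCommGroup M] {f g : tensor A B →+ M}
    (h : ∀ a b, f (tmul a b) = g (tmul a b)) : f = g := by
  ext x
  refine TensorProduct.induction_on (R := ℤ) (M := A) (N := B)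
    (motive := fun x => f (show tensor A B from x) = g (show tensor A B from x)) x ?_ ?_ ?_
  · exact f.map_zero.trans g.map_zero.symm
  · exact h
  · intro x y hx hy
    exact (f.map_add x y).trans ((congrArg₂ _ hx hy).trans (g.map_add x y).symm)

theorem tensor_hom_ext {A B C : POGu.{u}} {f g : tensor A B ⟶ C}
    (h : ∀ a b, f (tmul a b) = g (tmul a b)) : f = g :=
  Hom.ext (addHom_ext (f := Hom.toAddMonoidHom f) (g := Hom.toAddMonoidHom g) h)

/-- Universal property of the tensor product. -/
theorem existsUnique_lift {A B C : POGu.{u}} (β : A → B → C) (h : IsBihom β) :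
    ∃! f : tensor A B ⟶ C, ∀ a b, f (tmul a b) = β a b :=
  ⟨lift β h, lift_tmul β h, fun _ hg => tensor_hom_ext fun a b => hg a b⟩

/-- The tensor product of two morphisms. -/
def tensorMap {A B C D : POGu.{u}} (f : A ⟶ C) (g : B ⟶ D) : tensor A B ⟶ tensor C D :=
  lift (fun a b => tmul (f a) (g b))
    { add_left := fun a a' b => by rw [map_add, (tmul_isBihom C D).add_left]
      add_right := fun a b b' => by rw [map_add, (tmul_isBihom C D).add_right]
      nonneg := fun a b ha hb => (tmul_isBihom C D).nonneg _ _ (map_nonneg f ha) (map_nonneg g hb)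
      map_unit := by rw [map_unit, map_unit]; rfl }

/-- The map `a ↦ b ↦ a ⊗ b`. -/
def tmulHom (A B : POGu.{u}) : A →+ B →+ tensor A B :=
  AddMonoidHom.mk' (fun a => AddMonoidHom.mk' (tmul a) ((tmul_isBihom A B).add_right a))
    (fun a a' => by ext b; exact (tmul_isBihom A B).add_left a a' b)

theorem tmul_nonneg {A B : POGu.{u}} {a : A} {b : B} (ha : 0 ≤ a) (hb : 0 ≤ b) :
    0 ≤ tmul a b := (tmul_isBihom A B).nonneg a b ha hb

/-- The monoidal unit `(ℤ, 1)`. -/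
noncomputable def int : POGu.{u} where
  carrier := ULift.{u} ℤ
  ordered := { add_le_add_left := fun a b h c => add_le_add_left (α := ℤ) h c.down }
  unit := ⟨1⟩
  unit_nonneg := (zero_le_one : (0 : ℤ) ≤ 1)
  exists_le_nsmul x := ⟨x.down.toNat, by
    change x.down ≤ ((x.down.toNat • (⟨1⟩ : ULift.{u} ℤ)).down)
    rw [ULift.smul_down]
    simp⟩

theorem add_tmul {A B : POGu.{u}} (a a' : A) (b : B) :
    tmul (a + a') b = tmul a b + tmul a' b := (tmul_isBihom A B).add_left a a' b

theorem tmul_add {A B : POGu.{u}} (a : A) (b b' : B) :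
    tmul a (b + b') = tmul a b + tmul a b' := (tmul_isBihom A B).add_right a b b'

theorem tensor_induction {A B : POGu.{u}} {P : tensor A B → Prop} (x : tensor A B)
    (h : ∀ a b, P (tmul a b)) (hadd : ∀ x y, P x → P y → P (x + y)) : P x :=
  TensorProduct.induction_on (R := ℤ) (M := A) (N := B) (motive := P) x
    (by have := h 0 0; rwa [show tmul (0 : A) (0 : B) = 0 from TensorProduct.zero_tmul _ _] at this)
    h hadd

theorem tensor_hom_ext₃ {A B C D : POGu.{u}} {f g : tensor (tensor A B) C ⟶ D}
    (h : ∀ a b c, f (tmul (tmul a b) c) = g (tmul (tmul a b) c)) : f = g :=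
  tensor_hom_ext fun x c => tensor_induction (P := fun x => f (tmul x c) = g (tmul x c)) x (fun a b => h a b c)
    (fun x y hx hy => by rw [add_tmul, map_add, map_add, hx, hy])

theorem tensor_hom_ext₃' {A B C D : POGu.{u}} {f g : tensor A (tensor B C) ⟶ D}
    (h : ∀ a b c, f (tmul a (tmul b c)) = g (tmul a (tmul b c))) : f = g :=
  tensor_hom_ext fun a x => tensor_induction (P := fun x => f (tmul a x) = g (tmul a x)) x (fun b c => h a b c)
    (fun x y hx hy => by rw [tmul_add, map_add, map_add, hx, hy])

theorem tensor_hom_ext₄ {A B C D E : POGu.{u}} {f g : tensor (tensor (tensor A B) C) D ⟶ E}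
    (h : ∀ a b c d, f (tmul (tmul (tmul a b) c) d) = g (tmul (tmul (tmul a b) c) d)) : f = g :=
  tensor_hom_ext₃ fun x c d => tensor_induction
    (P := fun x => f (tmul (tmul x c) d) = g (tmul (tmul x c) d)) x (fun a b => h a b c d)
    (fun x y hx hy => by rw [add_tmul, add_tmul, map_add, map_add, hx, hy])

theorem zsmul_tmul {A B : POGu.{u}} (n : ℤ) (a : A) (b : B) : tmul (n • a) b = tmul a (n • b) :=
  TensorProduct.smul_tmul n a b

/-- The associator `(a ⊗ b) ⊗ c ↦ a ⊗ (b ⊗ c)`. -/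
def assoc (A B C : POGu.{u}) : tensor (tensor A B) C ≅ tensor A (tensor B C) where
  hom := ofAdd
    (liftAdd (liftAdd (AddMonoidHom.mk' (fun a =>
        AddMonoidHom.mk' (fun b => (tmulHom A (tensor B C) a).comp (tmulHom B C b))
          (fun b b' => by ext c; simp))
      (fun a a' => by ext b c; simp))))
    (fun x c hx hc => nonneg_induction
      (P := fun x => 0 ≤ liftAdd _ (tmul x c))
      (fun a b ha hb => tmul_nonneg ha (tmul_nonneg hb hc))
      (by simp) (fun x y hx hy => by simpa using add_nonneg hx hy) hx)
    rfl
  inv := ofAdd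
    (liftAdd (AddMonoidHom.mk' (fun a =>
        liftAdd (AddMonoidHom.mk' (fun b => tmulHom (tensor A B) C (tmulHom A B a b))
          (fun b b' => by ext c; simp)))
      (fun a a' => addHom_ext fun b c => by simp)))
    (fun a x ha hx => nonneg_induction
      (P := fun x => 0 ≤ liftAdd _ (tmul a x))
      (fun b c hb hc => tmul_nonneg (tmul_nonneg ha hb) hc)
      (by simp) (fun x y hx hy => by simpa using add_nonneg hx hy) hx)
    rfl
  hom_inv_id := tensor_hom_ext₃ fun _ _ _ => rfl
  inv_hom_id := tensor_hom_ext₃' fun _ _ _ => rfl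

/-- The left unitor `n ⊗ a ↦ n • a`. -/
noncomputable def leftUnitor (A : POGu.{u}) : tensor int.{u} A ≅ A where
  hom := lift (fun n a => n.down • a)
    { add_left := fun n m a => add_smul n.down m.down a
      add_right := fun n a b => smul_add n.down a b
      nonneg := fun n a hn ha => zsmul_nonneg ha hn
      map_unit := one_smul ℤ A.unit }
  inv := show Hom _ _ from ⟨tmulHom int.{u} A int.{u}.unit,
    fun x hx => tmul_nonneg int.{u}.unit_nonneg hx, rfl⟩
  hom_inv_id := tensor_hom_ext fun n a => by
    change tmul int.unit (n.down • a) = tmul n a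
    rw [← zsmul_tmul]
    congr 1
    exact ULift.ext _ _ (mul_one n.down)
  inv_hom_id := hom_ext fun a => one_smul ℤ a

/-- The right unitor `a ⊗ n ↦ n • a`. -/
noncomputable def rightUnitor (A : POGu.{u}) : tensor A int.{u} ≅ A where
  hom := lift (fun a n => n.down • a)
    { add_left := fun a b n => smul_add n.down a b
      add_right := fun a n m => add_smul n.down m.down a
      nonneg := fun a n ha hn => zsmul_nonneg ha hn
      map_unit := one_smul ℤ A.unit }
  inv := show Hom _ _ from ⟨(tmulHom A int.{u}).flip int.{u}.unit,
    fun x hx => tmul_nonneg hx int.{u}.unit_nonneg, rfl⟩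
  hom_inv_id := tensor_hom_ext fun a n => by
    change tmul (n.down • a) int.unit = tmul a n
    rw [zsmul_tmul]
    congr 1
    exact ULift.ext _ _ (mul_one n.down)
  inv_hom_id := hom_ext fun a => one_smul ℤ a

/-- The monoidal data on `POG_u`: tensor product, unit `(ℤ, 1)`, associator and unitors. -/
noncomputable instance : MonoidalCategoryStruct POGu.{u} where
  tensorObj := tensor
  tensorHom := tensorMap
  whiskerLeft A _ _ f := tensorMap (𝟙 A) f
  whiskerRight f B := tensorMap f (𝟙 B)
  tensorUnit := int
  associator := assoc
  leftUnitor := leftUnitor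
  rightUnitor := rightUnitor

/-- The monoidal category `POG_u`. -/
noncomputable instance : MonoidalCategory POGu.{u} := MonoidalCategory.ofTensorHom
  (id_tensorHom_id := fun _ _ => tensor_hom_ext fun _ _ => rfl)
  (id_tensorHom := fun _ _ _ _ => rfl)
  (tensorHom_id := fun _ _ => rfl)
  (tensorHom_comp_tensorHom := fun _ _ _ _ => tensor_hom_ext fun _ _ => rfl)
  (associator_naturality := fun _ _ _ => tensor_hom_ext₃ fun _ _ _ => rfl)
  (leftUnitor_naturality := fun f => tensor_hom_ext fun n a => (map_zsmul (ConcreteCategory.hom f) n.down a).symm)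
  (rightUnitor_naturality := fun f => tensor_hom_ext fun a n => (map_zsmul (ConcreteCategory.hom f) n.down a).symm)
  (pentagon := fun _ _ _ _ => tensor_hom_ext₄ fun _ _ _ _ => rfl)
  (triangle := fun _ _ => tensor_hom_ext₃ fun a n b => (zsmul_tmul n.down a b).symm)

end POGu

/-- Effect algebras. The partial operation `⊕` is `osum`, where `osum a b = none` means that
`a ⊕ b` is undefined; `osum_assoc` is the Kleene identity `(a ⊕ b) ⊕ c = a ⊕ (b ⊕ c)`. -/
class EffectAlgebra (E : Type u) extends Zero E, One E where
  osum : E → E → Option E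
  compl : E → E
  osum_comm : ∀ a b, osum a b = osum b a
  osum_assoc : ∀ a b c,
    ((osum a b).bind fun d => osum d c) = (osum b c).bind fun d => osum a d
  osum_eq_one_iff : ∀ a b, osum a b = some 1 ↔ b = compl a
  osum_one_defined_iff : ∀ a, (∃ d, osum a 1 = some d) ↔ a = 0
  zero_osum_one : osum 0 1 = some 1

namespace EffectAlgebra

/-- `E` with an absorbing element adjoined for undefined sums; this turns `⊕` into a total
operation. -/
def Tot (E : Type u) : Type u := Option E

/-- The inclusion of `E`. -/
def Tot.of {E : Type u} (a : E) : Tot E := some a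

theorem Tot.of_injective {E : Type u} {a b : E} (h : Tot.of a = Tot.of b) : a = b :=
  Option.some_injective _ h

variable {E F G : Type u} [EffectAlgebra E] [EffectAlgebra F] [EffectAlgebra G]

theorem zero_osum (a : E) : osum 0 a = some a := by
  have h1 : osum a (compl a) = some 1 := (osum_eq_one_iff _ _).2 rfl
  have h2 := osum_assoc 0 a (compl a)
  rw [h1, Option.bind_some, zero_osum_one] at h2
  obtain ⟨d, hd, hd'⟩ := Option.bind_eq_some_iff.1 h2
  rw [osum_comm] at hd' h1
  exact hd.trans (congrArg some
    (((osum_eq_one_iff _ _).1 hd').trans ((osum_eq_one_iff _ _).1 h1).symm))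

instance : Add (Tot E) := ⟨fun x y => Option.bind x fun a => Option.bind y fun b => osum a b⟩

instance : Zero (Tot E) := ⟨Tot.of 0⟩

instance : AddCommMonoid (Tot E) where
  add_assoc x y z := by
    cases x with
    | none => rfl
    | some a =>
      cases y with
      | none => rfl
      | some b =>
        cases z with
        | none => change (osum a b).bind (fun _ => none) = none; simp
        | some c => exact osum_assoc a b c
  add_comm x y := by
    cases x <;> cases y <;> first | rfl | exact osum_comm _ _
  zero_add x := by
    cases x with
    | none => rfl
    | some a => exact zero_osum a
  add_zero x := by
    cases x with
    | none => rfl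
    | some a => exact (osum_comm _ _).trans (zero_osum a)
  nsmul := nsmulRec

theorem Tot.of_add_of_eq (a b c : E) : Tot.of a + Tot.of b = Tot.of c ↔ osum a b = some c :=
  Iff.rfl

theorem Tot.of_zero : Tot.of (0 : E) = 0 := rfl

theorem Tot.exists_of_add {x y : Tot E} {c : E} (h : x + y = Tot.of c) :
    ∃ a b, x = Tot.of a ∧ y = Tot.of b := by
  cases x with
  | none => exact absurd h (by rintro ⟨⟩)
  | some a =>
    cases y with
    | none => exact absurd h (by rintro ⟨⟩)
    | some b => exact ⟨a, b, rfl, rfl⟩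

theorem Tot.of_add_compl (a : E) : Tot.of a + Tot.of (compl a) = Tot.of 1 :=
  (osum_eq_one_iff a _).2 rfl

/-- Cancellation. -/
theorem Tot.cancel {x y z : Tot E} {c : E} (h : x + y = Tot.of c) (h' : x + z = Tot.of c) :
    y = z := by
  obtain ⟨a, b, rfl, rfl⟩ := Tot.exists_of_add h
  have h1 : ∀ y : Tot E, Tot.of a + y = Tot.of c →
      ∃ d, Tot.of a + Tot.of (compl c) = Tot.of d ∧ y = Tot.of (compl d) := by
    intro y hy
    have h2 : (Tot.of a + Tot.of (compl c)) + y = Tot.of 1 := by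
      rw [add_right_comm, hy, Tot.of_add_compl]
    obtain ⟨d, e, hd, rfl⟩ := Tot.exists_of_add h2
    refine ⟨d, hd, ?_⟩
    rw [hd] at h2
    exact congrArg _ ((osum_eq_one_iff _ _).1 h2)
  obtain ⟨d, hd, h3⟩ := h1 _ h
  obtain ⟨d', hd', h4⟩ := h1 _ h'
  rw [h3, h4, Tot.of_injective (hd.symm.trans hd')]

/-- Positivity. -/
theorem Tot.eq_zero_of_add {x y : Tot E} (h : x + y = 0) : x = 0 := by
  obtain ⟨a, b, rfl, rfl⟩ := Tot.exists_of_add (h.trans Tot.of_zero.symm)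
  have h1 : Tot.of a + (Tot.of b + Tot.of 1) = Tot.of 1 := by
    rw [← add_assoc, h, zero_add]
  have h2 : Tot.of b + (Tot.of a + Tot.of 1) = Tot.of 1 := by
    rw [add_left_comm, h1]
  obtain ⟨_, d, -, hd⟩ := Tot.exists_of_add h2
  rw [(osum_one_defined_iff a).1 ⟨d, hd⟩, Tot.of_zero]

/-- Maps that preserve existing orthosums (homomorphisms of generalized effect algebras). -/
def IsAdd (f : E → F) : Prop :=
  ∀ a b c, osum a b = some c → osum (f a) (f b) = some (f c)

theorem IsAdd.map_zero {f : E → F} (h : IsAdd f) : f 0 = 0 := by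
  have h1 : Tot.of (f 0) + Tot.of (f 0) = Tot.of (f 0) := h 0 0 0 (zero_osum 0)
  exact Tot.of_injective (Tot.cancel h1 (add_zero _))

/-- Maps of two variables that preserve existing orthosums in each variable. -/
structure IsBiadd (β : E → F → G) : Prop where
  left : ∀ y, IsAdd fun x => β x y
  right : ∀ x, IsAdd (β x)

/-- Bihomomorphisms of effect algebras. -/
structure IsBihom (β : E → F → G) : Prop extends IsBiadd β where
  map_one : β 1 1 = 1

section Tensor

variable (E F) in
/-- The least congruence on finite formal sums of pairs that makes `(x, y) ↦ [(x, y)]` preserve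
existing orthosums in each variable, and for which complements with respect to `[(1, 1)]` are
unique and `0` is not a proper sum. -/
inductive TensorRel : Multiset (E × F) → Multiset (E × F) → Prop
  | refl (s) : TensorRel s s
  | symm {s t} : TensorRel s t → TensorRel t s
  | trans {s t r} : TensorRel s t → TensorRel t r → TensorRel s r
  | add {s t s' t'} : TensorRel s t → TensorRel s' t' → TensorRel (s + s') (t + t')
  | left {a b c : E} (y : F) : osum a b = some c → TensorRel ({(a, y)} + {(b, y)}) {(c, y)}
  | right {a b c : F} (x : E) : osum a b = some c → TensorRel ({(x, a)} + {(x, b)}) {(x, c)}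
  | cancel {s t t'} : TensorRel (s + t) {(1, 1)} → TensorRel (s + t') {(1, 1)} → TensorRel t t'
  | pos {s t} : TensorRel (s + t) 0 → TensorRel s 0

variable (E F) in
/-- `TensorRel` as an additive congruence. -/
def tensorCon : AddCon (Multiset (E × F)) where
  r := TensorRel E F
  iseqv := ⟨TensorRel.refl, TensorRel.symm, TensorRel.trans⟩
  add' := TensorRel.add

variable (E F) in
/-- Finite formal sums of simple tensors. -/
abbrev PreTensor : Type u := (tensorCon E F).Quotient

/-- The class of `(x, y)`. -/
def ptmul (x : E) (y : F) : PreTensor E F := ((({(x, y)} : Multiset (E × F))) : PreTensor E F)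

theorem ptmul_left {a b c : E} (y : F) (h : osum a b = some c) :
    ptmul a y + ptmul b y = ptmul c y := (AddCon.eq _).2 (TensorRel.left y h)

theorem ptmul_right {a b c : F} (x : E) (h : osum a b = some c) :
    ptmul x a + ptmul x b = ptmul x c := (AddCon.eq _).2 (TensorRel.right x h)

theorem PreTensor.cancel {p q r : PreTensor E F} (h : p + q = ptmul 1 1)
    (h' : p + r = ptmul 1 1) : q = r := by
  induction p using AddCon.induction_on
  induction q using AddCon.induction_on
  induction r using AddCon.induction_on
  exact (AddCon.eq _).2 (TensorRel.cancel ((AddCon.eq _).1 h) ((AddCon.eq _).1 h'))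

theorem PreTensor.eq_zero_of_add {p q : PreTensor E F} (h : p + q = 0) : p = 0 := by
  induction p using AddCon.induction_on
  induction q using AddCon.induction_on
  exact (AddCon.eq _).2 (TensorRel.pos ((AddCon.eq _).1 h))

theorem PreTensor.induction {P : PreTensor E F → Prop} (h0 : P 0)
    (h : ∀ x y q, P q → P (ptmul x y + q)) (p : PreTensor E F) : P p := by
  induction p using AddCon.induction_on with
  | H s =>
    induction s using Multiset.induction_on with
    | empty => exact h0
    | cons a s ih => exact h a.1 a.2 _ ih

variable (E F) in
/-- The carrier of `E ⊗ F`: the interval `[0, 1 ⊗ 1]` in `PreTensor E F`. -/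
@[ext]
structure Tensor : Type u where
  val : PreTensor E F
  le_one : ∃ q, val + q = ptmul 1 1

theorem Tensor.exists_of_add {p q r : PreTensor E F} (h : p + q + r = ptmul 1 1) :
    (∃ s, p + s = ptmul 1 1) ∧ (∃ s, q + s = ptmul 1 1) :=
  ⟨⟨q + r, by rw [← h, add_assoc]⟩, ⟨p + r, by rw [← h, add_left_comm, add_assoc]⟩⟩

open Classical in
/-- The partial sum on `E ⊗ F`. -/
noncomputable def Tensor.sum (p q : Tensor E F) : Option (Tensor E F) :=
  if h : ∃ r, (p.val + q.val) + r = ptmul 1 1 then some ⟨p.val + q.val, h⟩ else none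

theorem Tensor.sum_eq_some {p q r : Tensor E F} : p.sum q = some r ↔ p.val + q.val = r.val := by
  unfold Tensor.sum
  split_ifs with h
  · rw [Option.some_inj, Tensor.ext_iff]
  · refine iff_of_false (by simp) fun h' => h ?_
    rw [h']
    exact r.le_one

noncomputable instance : EffectAlgebra (Tensor E F) where
  zero := ⟨0, ptmul 1 1, zero_add _⟩
  one := ⟨ptmul 1 1, 0, add_zero _⟩
  osum := Tensor.sum
  compl p := ⟨p.le_one.choose, p.val, (add_comm _ _).trans p.le_one.choose_spec⟩
  osum_comm p q := Option.ext fun r => by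
    rw [Tensor.sum_eq_some, Tensor.sum_eq_some, add_comm]
  osum_assoc p q r := Option.ext fun t => by
    simp only [Option.bind_eq_some_iff, Tensor.sum_eq_some]
    have ht := t.le_one
    constructor
    · rintro ⟨d, hd, h⟩
      rw [← hd] at h
      rw [← h, add_assoc] at ht
      obtain ⟨w, hw⟩ := ht
      refine ⟨⟨q.val + r.val, p.val + w, ?_⟩, rfl, by rw [← add_assoc, h]⟩
      rw [← hw]
      abel
    · rintro ⟨d, hd, h⟩
      rw [← hd] at h
      rw [← h, ← add_assoc] at ht
      obtain ⟨w, hw⟩ := ht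
      refine ⟨⟨p.val + q.val, r.val + w, ?_⟩, rfl, by rw [add_assoc, h]⟩
      rw [← hw, ← add_assoc]
  osum_eq_one_iff p q := by
    rw [Tensor.sum_eq_some]
    constructor
    · exact fun h => Tensor.ext (PreTensor.cancel h p.le_one.choose_spec)
    · rintro rfl
      exact p.le_one.choose_spec
  osum_one_defined_iff p := by
    simp only [Tensor.sum_eq_some]
    constructor
    · rintro ⟨d, hd⟩
      obtain ⟨w, hw⟩ := d.le_one
      refine Tensor.ext (PreTensor.eq_zero_of_add (q := w) ?_)
      refine PreTensor.cancel (p := ptmul 1 1) ?_ (add_zero _)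
      rw [← hd] at hw
      rw [← add_assoc, add_comm (ptmul 1 1)]
      exact hw
    · rintro rfl
      exact ⟨⟨ptmul 1 1, 0, add_zero _⟩, zero_add _⟩
  zero_osum_one := Tensor.sum_eq_some.2 (zero_add _)

theorem Tensor.osum_eq_some {p q r : Tensor E F} : osum p q = some r ↔ p.val + q.val = r.val :=
  Tensor.sum_eq_some

/-- The simple tensor `x ⊗ y`. -/
def tmul (x : E) (y : F) : Tensor E F :=
  ⟨ptmul x y, ptmul (compl x) y + ptmul 1 (compl y), by
    rw [← add_assoc, ptmul_left y ((osum_eq_one_iff x _).2 rfl),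
      ptmul_right 1 ((osum_eq_one_iff y _).2 rfl)]⟩

theorem tmul_isBihom : IsBihom (tmul : E → F → Tensor E F) where
  left y _ _ _ h := Tensor.osum_eq_some.2 (ptmul_left y h)
  right x _ _ _ h := Tensor.osum_eq_some.2 (ptmul_right x h)
  map_one := rfl

theorem IsAdd.ext {f g : Tensor E F → G} (hf : IsAdd f) (hg : IsAdd g)
    (h : ∀ x y, f (tmul x y) = g (tmul x y)) (p : Tensor E F) : f p = g p := by
  obtain ⟨p, hp⟩ := p
  induction p using PreTensor.induction with
  | h0 => exact hf.map_zero.trans hg.map_zero.symm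
  | h x y q ih =>
    have hq := (Tensor.exists_of_add hp.choose_spec).2
    have hs : osum (tmul x y) (⟨q, hq⟩ : Tensor E F) = some ⟨ptmul x y + q, hp⟩ :=
      Tensor.osum_eq_some.2 rfl
    have h1 := hf _ _ _ hs
    rw [h, ih hq, hg _ _ _ hs] at h1
    exact (Option.some_injective _ h1).symm

/-- The extension of a biadditive map to formal sums, with values in `Tot G`. -/
def preLift (β : E → F → G) (h : IsBiadd β) : PreTensor E F →+ Tot G :=
  (tensorCon E F).lift
    (Multiset.sumAddMonoidHom.comp (Multiset.mapAddMonoidHom fun p => Tot.of (β p.1 p.2))) (by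
      intro s t hst
      change TensorRel E F s t at hst
      rw [AddCon.ker_rel]
      induction hst with
      | refl => rfl
      | symm _ ih => exact ih.symm
      | trans _ _ ih ih' => exact ih.trans ih'
      | add _ _ ih ih' => rw [map_add, map_add, ih, ih']
      | left y hab =>
        rw [map_add]
        simpa using (Tot.of_add_of_eq _ _ _).2 (h.left y _ _ _ hab)
      | right x hab =>
        rw [map_add]
        simpa using (Tot.of_add_of_eq _ _ _).2 (h.right x _ _ _ hab)
      | cancel _ _ ih ih' =>
        rw [map_add] at ih ih'
        exact Tot.cancel (c := β 1 1) (by simpa using ih) (by simpa using ih')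
      | pos _ ih =>
        rw [map_add] at ih
        rw [map_zero] at ih ⊢
        exact Tot.eq_zero_of_add ih)

theorem preLift_ptmul (β : E → F → G) (h : IsBiadd β) (x : E) (y : F) :
    preLift β h (ptmul x y) = Tot.of (β x y) :=
  Multiset.sum_singleton (Tot.of (β x y))

theorem exists_preLift (β : E → F → G) (h : IsBiadd β) (p : Tensor E F) :
    ∃ c, preLift β h p.val = Tot.of c := by
  obtain ⟨q, hq⟩ := p.le_one
  have h1 : preLift β h p.val + preLift β h q = Tot.of (β 1 1) := by
    rw [← map_add, hq, preLift_ptmul]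
  obtain ⟨c, _, hc, _⟩ := Tot.exists_of_add h1
  exact ⟨c, hc⟩

/-- The map on `E ⊗ F` induced by a biadditive map. -/
noncomputable def lift (β : E → F → G) (h : IsBiadd β) (p : Tensor E F) : G :=
  (exists_preLift β h p).choose

theorem of_lift (β : E → F → G) (h : IsBiadd β) (p : Tensor E F) :
    Tot.of (lift β h p) = preLift β h p.val := (exists_preLift β h p).choose_spec.symm

@[simp]
theorem lift_tmul (β : E → F → G) (h : IsBiadd β) (x : E) (y : F) :
    lift β h (tmul x y) = β x y :=
  Tot.of_injective ((of_lift β h _).trans (preLift_ptmul β h x y))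

theorem lift_isAdd (β : E → F → G) (h : IsBiadd β) : IsAdd (lift β h) := fun p q r hpq => by
  rw [← Tot.of_add_of_eq]
  rw [of_lift, of_lift, of_lift, ← map_add, Tensor.osum_eq_some.1 hpq]

theorem osum_lift {β β' β'' : E → F → G} (h : IsBiadd β) (h' : IsBiadd β') (h'' : IsBiadd β'')
    (H : ∀ x y, osum (β x y) (β' x y) = some (β'' x y)) (p : Tensor E F) :
    osum (lift β h p) (lift β' h' p) = some (lift β'' h'' p) := by
  rw [← Tot.of_add_of_eq]
  rw [of_lift, of_lift, of_lift]
  induction p.val using PreTensor.induction with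
  | h0 => simp
  | h x y q ih =>
    rw [map_add, map_add, map_add, ← ih, add_add_add_comm, preLift_ptmul, preLift_ptmul,
      preLift_ptmul]
    congr 1
    exact H x y

end Tensor

end EffectAlgebra

/-- An object of `EA`: an effect algebra. -/
structure EA : Type (u + 1) where
  carrier : Type u
  [str : EffectAlgebra carrier]

namespace EA

open EffectAlgebra

instance : CoeSort EA.{u} (Type u) := ⟨EA.carrier⟩

attribute [instance] EA.str

/-- Homomorphisms of effect algebras. -/
@[ext]
structure Hom (E F : EA.{u}) : Type u where
  toFun : E → F
  map_osum' : ∀ a b c, osum a b = some c → osum (toFun a) (toFun b) = some (toFun c)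
  map_one' : toFun 1 = 1

instance (E F : EA.{u}) : FunLike (Hom E F) E F where
  coe f := f.toFun
  coe_injective _ _ h := Hom.ext h

instance : Category EA.{u} where
  Hom E F := Hom E F
  id E := ⟨fun x => x, fun _ _ _ h => h, rfl⟩
  comp f g := ⟨fun x => g.toFun (f.toFun x),
    fun a b c h => g.map_osum' _ _ _ (f.map_osum' a b c h),
    (congrArg g.toFun f.map_one').trans g.map_one'⟩

instance : ConcreteCategory EA.{u} Hom where
  hom f := f
  ofHom f := f
  id_apply _ := rfl
  comp_apply _ _ _ := rfl

theorem isAdd {E F : EA.{u}} (f : E ⟶ F) : IsAdd f := Hom.map_osum' f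

theorem map_one {E F : EA.{u}} (f : E ⟶ F) : f 1 = 1 := Hom.map_one' f

theorem hom_ext {E F : EA.{u}} {f g : E ⟶ F} (h : ∀ x : E, f x = g x) : f = g :=
  DFunLike.ext (F := Hom E F) f g h

/-- The tensor product `E ⊗ F`. -/
noncomputable def tensor (E F : EA.{u}) : EA.{u} := ⟨Tensor E F⟩

/-- The simple tensor `x ⊗ y`. -/
noncomputable def tmul {E F : EA.{u}} (x : E) (y : F) : tensor E F := EffectAlgebra.tmul x y

theorem tmul_isBihom (E F : EA.{u}) : IsBihom (G := tensor E F) (tmul (E := E) (F := F)) :=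
  EffectAlgebra.tmul_isBihom

/-- The morphism out of the tensor product induced by a bihomomorphism. -/
noncomputable def lift {E F G : EA.{u}} (β : E → F → G) (h : IsBihom β) : tensor E F ⟶ G :=
  show Hom _ _ from ⟨EffectAlgebra.lift β h.toIsBiadd, lift_isAdd β h.toIsBiadd,
    (EffectAlgebra.lift_tmul β h.toIsBiadd 1 1).trans h.map_one⟩

@[simp]
theorem lift_tmul {E F G : EA.{u}} (β : E → F → G) (h : IsBihom β) (x : E) (y : F) :
    lift β h (tmul x y) = β x y := EffectAlgebra.lift_tmul β h.toIsBiadd x y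

theorem tensor_hom_ext {E F G : EA.{u}} {f g : tensor E F ⟶ G}
    (h : ∀ x y, f (tmul x y) = g (tmul x y)) : f = g :=
  hom_ext (IsAdd.ext (isAdd f) (isAdd g) h)

/-- Universal property of the tensor product. -/
theorem existsUnique_lift {E F G : EA.{u}} (β : E → F → G) (h : IsBihom β) :
    ∃! f : tensor E F ⟶ G, ∀ x y, f (tmul x y) = β x y :=
  ⟨lift β h, lift_tmul β h, fun _ hg => tensor_hom_ext fun x y =>
    (hg x y).trans (lift_tmul β h x y).symm⟩

theorem tensor_hom_ext₃ {E F G H : EA.{u}} {f g : tensor (tensor E F) G ⟶ H}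
    (h : ∀ x y z, f (tmul (tmul x y) z) = g (tmul (tmul x y) z)) : f = g :=
  tensor_hom_ext fun p z => IsAdd.ext
    (fun _ _ _ hp => isAdd f _ _ _ ((tmul_isBihom _ G).left z _ _ _ hp))
    (fun _ _ _ hp => isAdd g _ _ _ ((tmul_isBihom _ G).left z _ _ _ hp)) (fun x y => h x y z) p

theorem tensor_hom_ext₃' {E F G H : EA.{u}} {f g : tensor E (tensor F G) ⟶ H}
    (h : ∀ x y z, f (tmul x (tmul y z)) = g (tmul x (tmul y z))) : f = g :=
  tensor_hom_ext fun x p => IsAdd.ext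
    (fun _ _ _ hp => isAdd f _ _ _ ((tmul_isBihom E _).right x _ _ _ hp))
    (fun _ _ _ hp => isAdd g _ _ _ ((tmul_isBihom E _).right x _ _ _ hp)) (fun y z => h x y z) p

theorem tensor_hom_ext₄ {E F G H K : EA.{u}} {f g : tensor (tensor (tensor E F) G) H ⟶ K}
    (h : ∀ x y z w, f (tmul (tmul (tmul x y) z) w) = g (tmul (tmul (tmul x y) z) w)) : f = g :=
  tensor_hom_ext₃ fun p z w => IsAdd.ext
    (fun _ _ _ hp => isAdd f _ _ _
      ((tmul_isBihom _ H).left w _ _ _ ((tmul_isBihom _ G).left z _ _ _ hp)))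
    (fun _ _ _ hp => isAdd g _ _ _
      ((tmul_isBihom _ H).left w _ _ _ ((tmul_isBihom _ G).left z _ _ _ hp)))
    (fun x y => h x y z w) p

/-- The tensor product of two morphisms. -/
noncomputable def tensorMap {E F G H : EA.{u}} (f : E ⟶ G) (g : F ⟶ H) :
    tensor E F ⟶ tensor G H :=
  lift (fun x y => tmul (f x) (g y))
    { left := fun y _ _ _ h => (tmul_isBihom G H).left _ _ _ _ (isAdd f _ _ _ h)
      right := fun x _ _ _ h => (tmul_isBihom G H).right _ _ _ _ (isAdd g _ _ _ h)
      map_one := by rw [map_one, map_one]; rfl }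

theorem tensorMap_tmul {E F G H : EA.{u}} (f : E ⟶ G) (g : F ⟶ H) (x : E) (y : F) :
    tensorMap f g (tmul x y) = tmul (f x) (g y) := lift_tmul _ _ x y

theorem assoc_left_aux (E F G : EA.{u}) (z : G) :
    IsBiadd (G := tensor E (tensor F G)) fun (x : E) (y : F) => tmul x (tmul y z) where
  left _ := (tmul_isBihom E (tensor F G)).left _
  right x _ _ _ h := (tmul_isBihom E (tensor F G)).right x _ _ _ ((tmul_isBihom F G).left z _ _ _ h)

theorem assoc_right_aux (E F G : EA.{u}) (x : E) :
    IsBiadd (G := tensor (tensor E F) G) fun (y : F) (z : G) => tmul (tmul x y) z where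
  left z _ _ _ h := (tmul_isBihom (tensor E F) G).left z _ _ _ ((tmul_isBihom E F).right x _ _ _ h)
  right _ := (tmul_isBihom (tensor E F) G).right _

/-- The map `(x ⊗ y) ⊗ z ↦ x ⊗ (y ⊗ z)`. -/
noncomputable def assocHom (E F G : EA.{u}) : tensor (tensor E F) G ⟶ tensor E (tensor F G) :=
  lift (fun p z => EffectAlgebra.lift _ (assoc_left_aux E F G z) p)
    { left := fun _ => lift_isAdd _ _
      right := fun p _ _ _ h => osum_lift _ _ _ (fun x y =>
        (tmul_isBihom E (tensor F G)).right x _ _ _ ((tmul_isBihom F G).right y _ _ _ h)) p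
      map_one := EffectAlgebra.lift_tmul _ _ 1 1 }

/-- The map `x ⊗ (y ⊗ z) ↦ (x ⊗ y) ⊗ z`. -/
noncomputable def assocInv (E F G : EA.{u}) : tensor E (tensor F G) ⟶ tensor (tensor E F) G :=
  lift (fun x p => EffectAlgebra.lift _ (assoc_right_aux E F G x) p)
    { left := fun p _ _ _ h => osum_lift _ _ _ (fun y z =>
        (tmul_isBihom (tensor E F) G).left z _ _ _ ((tmul_isBihom E F).left y _ _ _ h)) p
      right := fun _ => lift_isAdd _ _
      map_one := EffectAlgebra.lift_tmul _ _ 1 1 }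

theorem assocHom_tmul {E F G : EA.{u}} (x : E) (y : F) (z : G) :
    assocHom E F G (tmul (tmul x y) z) = tmul x (tmul y z) :=
  (lift_tmul _ _ _ z).trans (EffectAlgebra.lift_tmul _ _ x y)

theorem assocInv_tmul {E F G : EA.{u}} (x : E) (y : F) (z : G) :
    assocInv E F G (tmul x (tmul y z)) = tmul (tmul x y) z :=
  (lift_tmul _ _ x _).trans (EffectAlgebra.lift_tmul _ _ y z)

/-- The associator. -/
noncomputable def assoc (E F G : EA.{u}) : tensor (tensor E F) G ≅ tensor E (tensor F G) where
  hom := assocHom E F G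
  inv := assocInv E F G
  hom_inv_id := tensor_hom_ext₃ fun x y z => by
    rw [ConcreteCategory.comp_apply, assocHom_tmul, assocInv_tmul]; rfl
  inv_hom_id := tensor_hom_ext₃' fun x y z => by
    rw [ConcreteCategory.comp_apply, assocInv_tmul, assocHom_tmul]; rfl

/-- The two-element effect algebra `{0, 1}`. -/
def two : EA.{u} where
  carrier := ULift.{u} Bool
  str :=
    { zero := ⟨false⟩
      one := ⟨true⟩
      osum := fun a b => if a.down && b.down then none else some ⟨a.down || b.down⟩
      compl := fun a => ⟨!a.down⟩
      osum_comm := by rintro ⟨_ | _⟩ ⟨_ | _⟩ <;> rfl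
      osum_assoc := by rintro ⟨_ | _⟩ ⟨_ | _⟩ ⟨_ | _⟩ <;> rfl
      osum_eq_one_iff := by
        rintro ⟨_ | _⟩ ⟨_ | _⟩
        · exact iff_of_false (fun h => nomatch h) (fun h => nomatch h)
        · exact iff_of_true rfl rfl
        · exact iff_of_true rfl rfl
        · exact iff_of_false (fun h => nomatch h) (fun h => nomatch h)
      osum_one_defined_iff := by
        rintro ⟨_ | _⟩
        · exact iff_of_true ⟨_, rfl⟩ rfl
        · exact iff_of_false (fun ⟨_, h⟩ => nomatch h) (fun h => nomatch h)
      zero_osum_one := rfl }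

/-- `0 ⋅ x = 0` and `1 ⋅ x = x`. -/
def act {E : EA.{u}} (n : two.{u}) (x : E) : E := bif n.down then x else 0

theorem act_isAdd_left {E : EA.{u}} (x : E) : IsAdd fun n : two.{u} => act n x := by
  rintro ⟨_ | _⟩ ⟨_ | _⟩ c ⟨⟩
  · exact zero_osum 0
  · exact zero_osum x
  · exact (osum_comm _ _).trans (zero_osum x)

theorem act_isAdd_right {E : EA.{u}} (n : two.{u}) : IsAdd fun x : E => act n x := by
  rcases n with ⟨_ | _⟩
  · exact fun _ _ _ _ => zero_osum 0
  · exact fun _ _ _ h => h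

theorem act_isBihom (E : EA.{u}) : IsBihom fun (n : two.{u}) (x : E) => act n x :=
  ⟨⟨act_isAdd_left, act_isAdd_right⟩, rfl⟩

theorem act_isBihom' (E : EA.{u}) : IsBihom fun (x : E) (n : two.{u}) => act n x :=
  ⟨⟨act_isAdd_right, act_isAdd_left⟩, rfl⟩

theorem tmul_act {E F : EA.{u}} (x : E) (n : two.{u}) (y : F) :
    tmul (act n x) y = tmul x (act n y) := by
  rcases n with ⟨_ | _⟩
  · exact ((tmul_isBihom E F).left y).map_zero.trans ((tmul_isBihom E F).right x).map_zero.symm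
  · rfl

theorem act_one (n : two.{u}) : act n 1 = n := by
  rcases n with ⟨_ | _⟩ <;> rfl

theorem map_act {E F : EA.{u}} (f : E ⟶ F) (n : two.{u}) (x : E) : f (act n x) = act n (f x) := by
  rcases n with ⟨_ | _⟩
  · exact (isAdd f).map_zero
  · rfl

/-- The left unitor `1 ⊗ x ↦ x`. -/
noncomputable def leftUnitor (E : EA.{u}) : tensor two.{u} E ≅ E where
  hom := lift _ (act_isBihom E)
  inv := show Hom _ _ from ⟨tmul 1, (tmul_isBihom two E).right 1, rfl⟩
  hom_inv_id := tensor_hom_ext fun n x => by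
    rw [ConcreteCategory.comp_apply, lift_tmul]
    change tmul 1 (act n x) = tmul n x
    rw [← tmul_act, act_one]
  inv_hom_id := hom_ext fun x => lift_tmul _ (act_isBihom E) 1 x

/-- The right unitor `x ⊗ 1 ↦ x`. -/
noncomputable def rightUnitor (E : EA.{u}) : tensor E two.{u} ≅ E where
  hom := lift _ (act_isBihom' E)
  inv := show Hom _ _ from ⟨fun x => tmul x 1, (tmul_isBihom E two).left 1, rfl⟩
  hom_inv_id := tensor_hom_ext fun x n => by
    rw [ConcreteCategory.comp_apply, lift_tmul]
    change tmul (act n x) 1 = tmul x n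
    rw [tmul_act, act_one]
  inv_hom_id := hom_ext fun x => lift_tmul _ (act_isBihom' E) x 1

/-- The monoidal data on `EA`: tensor product, unit `two`, associator and unitors. -/
noncomputable instance : MonoidalCategoryStruct EA.{u} where
  tensorObj := tensor
  tensorHom := tensorMap
  whiskerLeft E _ _ f := tensorMap (𝟙 E) f
  whiskerRight f F := tensorMap f (𝟙 F)
  tensorUnit := two
  associator := assoc
  leftUnitor := leftUnitor
  rightUnitor := rightUnitor

/-- The monoidal category `EA`. -/
noncomputable instance : MonoidalCategory EA.{u} := MonoidalCategory.ofTensorHom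
  (id_tensorHom_id := fun _ _ => tensor_hom_ext fun x y => tensorMap_tmul _ _ x y)
  (id_tensorHom := fun _ _ _ _ => rfl)
  (tensorHom_id := fun _ _ => rfl)
  (tensorHom_comp_tensorHom := fun f₁ f₂ g₁ g₂ => tensor_hom_ext fun x y => by
    change tensorMap g₁ g₂ (tensorMap f₁ f₂ (tmul x y)) = tensorMap (f₁ ≫ g₁) (f₂ ≫ g₂) (tmul x y)
    simp only [tensorMap_tmul]; rfl)
  (associator_naturality := fun {X₁ X₂ X₃ Y₁ Y₂ Y₃} f g h => tensor_hom_ext₃ fun x y z => by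
    change assocHom Y₁ Y₂ Y₃ (tensorMap (tensorMap f g) h (tmul (tmul x y) z)) =
      tensorMap f (tensorMap g h) (assocHom X₁ X₂ X₃ (tmul (tmul x y) z))
    simp only [tensorMap_tmul, assocHom_tmul])
  (leftUnitor_naturality := fun {X Y} f => tensor_hom_ext fun n x => by
    change (leftUnitor Y).hom (tensorMap (𝟙 two) f (tmul n x)) = f ((leftUnitor X).hom (tmul n x))
    simp only [tensorMap_tmul, leftUnitor, lift_tmul, map_act]; rfl)
  (rightUnitor_naturality := fun {X Y} f => tensor_hom_ext fun x n => by
    change (rightUnitor Y).hom (tensorMap f (𝟙 two) (tmul x n)) = f ((rightUnitor X).hom (tmul x n))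
    simp only [tensorMap_tmul, rightUnitor, lift_tmul, map_act]; rfl)
  (pentagon := fun W X Y Z => tensor_hom_ext₄ fun w x y z => by
    change tensorMap (𝟙 W) (assocHom X Y Z) (assocHom W (tensor X Y) Z
      (tensorMap (assocHom W X Y) (𝟙 Z) (tmul (tmul (tmul w x) y) z))) =
      assocHom W X (tensor Y Z) (assocHom (tensor W X) Y Z (tmul (tmul (tmul w x) y) z))
    simp only [tensorMap_tmul, assocHom_tmul, ConcreteCategory.id_apply])
  (triangle := fun X Y => tensor_hom_ext₃ fun x n y => by
    change tensorMap (𝟙 X) (leftUnitor Y).hom (assocHom X two Y (tmul (tmul x n) y)) =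
      tensorMap (rightUnitor X).hom (𝟙 Y) (tmul (tmul x n) y)
    simp only [tensorMap_tmul, assocHom_tmul, leftUnitor, rightUnitor, lift_tmul,
      ConcreteCategory.id_apply, tmul_act])

end EA

/-- The interval effect algebra `Γ(A, u)` on `{x : A | 0 ≤ x ≤ u}`, with `x ⊕ y = x + y` whenever
`x + y ≤ u`. -/
structure POGu.Interval (A : POGu.{u}) : Type u where
  val : A
  nonneg : 0 ≤ val
  le_unit : val ≤ A.unit

namespace POGu.Interval

variable {A : POGu.{u}}

theorem ext {x y : A.Interval} (h : x.val = y.val) : x = y := by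
  cases x; cases y; congr

open Classical in
/-- The partial sum on `Γ(A, u)`. -/
noncomputable def sum (x y : A.Interval) : Option A.Interval :=
  if h : x.val + y.val ≤ A.unit then some ⟨x.val + y.val, add_nonneg x.nonneg y.nonneg, h⟩
  else none

theorem sum_eq_some {x y z : A.Interval} : x.sum y = some z ↔ x.val + y.val = z.val := by
  unfold sum
  split_ifs with h
  · rw [Option.some_inj]
    exact ⟨fun h => congrArg val h, fun h => ext h⟩
  · exact iff_of_false (by simp) fun h' => h (h' ▸ z.le_unit)

noncomputable instance : EffectAlgebra A.Interval where
  zero := ⟨0, le_rfl, A.unit_nonneg⟩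
  one := ⟨A.unit, A.unit_nonneg, le_rfl⟩
  osum := sum
  compl x := ⟨A.unit - x.val, sub_nonneg.2 x.le_unit, sub_le_self _ x.nonneg⟩
  osum_comm x y := Option.ext fun r => by rw [sum_eq_some, sum_eq_some, add_comm]
  osum_assoc x y z := Option.ext fun t => by
    simp only [Option.bind_eq_some_iff, sum_eq_some]
    constructor
    · rintro ⟨d, hd, h⟩
      rw [← hd, add_assoc] at h
      exact ⟨⟨y.val + z.val, add_nonneg y.nonneg z.nonneg,
        (le_add_of_nonneg_left x.nonneg).trans (h.le.trans t.le_unit)⟩, rfl, h⟩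
    · rintro ⟨d, hd, h⟩
      rw [← hd, ← add_assoc] at h
      exact ⟨⟨x.val + y.val, add_nonneg x.nonneg y.nonneg,
        (le_add_of_nonneg_right z.nonneg).trans (h.le.trans t.le_unit)⟩, rfl, h⟩
  osum_eq_one_iff x y := by
    rw [sum_eq_some]
    constructor
    · exact fun h => ext (eq_sub_of_add_eq' h)
    · rintro rfl
      exact add_sub_cancel _ _
  osum_one_defined_iff x := by
    simp only [sum_eq_some]
    constructor
    · rintro ⟨d, hd⟩
      refine ext (le_antisymm ?_ x.nonneg)
      have h : x.val + A.unit ≤ A.unit := hd.le.trans d.le_unit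
      exact add_le_iff_nonpos_left.1 h
    · rintro rfl
      exact ⟨⟨A.unit, A.unit_nonneg, le_rfl⟩, zero_add _⟩
  zero_osum_one := sum_eq_some.2 (zero_add _)

theorem osum_eq_some {x y z : A.Interval} :
    EffectAlgebra.osum x y = some z ↔ x.val + y.val = z.val := sum_eq_some

end POGu.Interval

/-- The functor `Γ : POG_u ⥤ EA`. -/
noncomputable def intervalFunctor : POGu.{u} ⥤ EA.{u} where
  obj A := ⟨A.Interval⟩
  map {A B} f := show EA.Hom _ _ from
    { toFun := fun x => ⟨f x.val, POGu.map_nonneg f x.nonneg, by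
        rw [← POGu.map_unit f, ← sub_nonneg, ← map_sub]
        exact POGu.map_nonneg f (sub_nonneg.2 x.le_unit)⟩
      map_osum' := fun x y z h => POGu.Interval.osum_eq_some.2
        ((map_add (ConcreteCategory.hom f) x.val y.val).symm.trans (congrArg f (POGu.Interval.osum_eq_some.1 h)))
      map_one' := POGu.Interval.ext (POGu.map_unit f) }

namespace EA

open EffectAlgebra

/-- In the free Abelian group on `E`: the submonoid generated by `E` and by the elements
`±(a + b - (a ⊕ b))`. -/
def preCone (E : EA.{u}) : AddSubmonoid (FreeAbelianGroup E) :=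
  AddSubmonoid.closure {z | (∃ x, z = FreeAbelianGroup.of x) ∨
    ∃ a b c, osum a b = some c ∧
      (z = FreeAbelianGroup.of a + FreeAbelianGroup.of b - FreeAbelianGroup.of c ∨
        z = FreeAbelianGroup.of c - (FreeAbelianGroup.of a + FreeAbelianGroup.of b))}

/-- The elements that have to vanish in a partially ordered quotient in which `preCone E` is
positive. -/
def nulls (E : EA.{u}) : AddSubgroup (FreeAbelianGroup E) where
  carrier := {z | z ∈ preCone E ∧ -z ∈ preCone E}
  zero_mem' := ⟨zero_mem _, by rw [neg_zero]; exact zero_mem _⟩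
  add_mem' := fun hx hy => ⟨add_mem hx.1 hy.1, by rw [neg_add]; exact add_mem hx.2 hy.2⟩
  neg_mem' := fun hx => ⟨hx.2, by rw [neg_neg]; exact hx.1⟩

/-- The positive cone of the universal group: all finite sums of classes of elements of `E`. -/
def cone (E : EA.{u}) : AddGroupCone (FreeAbelianGroup E ⧸ nulls E) :=
  { (preCone E).map (QuotientAddGroup.mk' (nulls E)) with
    eq_zero_of_mem_of_neg_mem' := by
      rintro _ ⟨p, hp, rfl⟩ ⟨q, hq, h⟩
      have h1 : q + p ∈ nulls E := by
        rw [← QuotientAddGroup.eq_zero_iff, QuotientAddGroup.mk_add]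
        exact (congrArg (· + _) h).trans (neg_add_cancel _)
      refine (QuotientAddGroup.eq_zero_iff p).2 ⟨hp, ?_⟩
      have := add_mem hq h1.2
      rwa [neg_add, add_neg_cancel_left] at this }

/-- The universal group of `E`. -/
def universalGroup (E : EA.{u}) : POGu.{u} :=
  letI : PartialOrder (FreeAbelianGroup E ⧸ nulls E) := PartialOrder.mkOfAddGroupCone (cone E)
  haveI : IsOrderedAddMonoid (FreeAbelianGroup E ⧸ nulls E) := IsOrderedAddMonoid.mkOfCone (cone E)
  have hpos : ∀ z ∈ preCone E, (0 : FreeAbelianGroup E ⧸ nulls E) ≤ QuotientAddGroup.mk' _ z :=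
    fun z hz => by
      change QuotientAddGroup.mk' (nulls E) z - 0 ∈ cone E
      rw [sub_zero]
      exact ⟨z, hz, rfl⟩
  have hof : ∀ x : E, FreeAbelianGroup.of x ∈ preCone E :=
    fun x => AddSubmonoid.subset_closure (Or.inl ⟨x, rfl⟩)
  { carrier := FreeAbelianGroup E ⧸ nulls E
    unit := QuotientAddGroup.mk' _ (FreeAbelianGroup.of 1)
    unit_nonneg := hpos _ (hof 1)
    exists_le_nsmul := fun x => by
      obtain ⟨z, rfl⟩ := QuotientAddGroup.mk'_surjective _ x
      induction z using FreeAbelianGroup.induction_on with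
      | zero => exact ⟨0, by simp⟩
      | of x =>
        refine ⟨1, ?_⟩
        have h1 : osum x (compl x) = some 1 := (osum_eq_one_iff _ _).2 rfl
        rw [← sub_nonneg, one_smul, ← map_sub]
        refine hpos _ ?_
        have h2 : FreeAbelianGroup.of (1 : E) - (FreeAbelianGroup.of x +
            FreeAbelianGroup.of (compl x)) ∈ preCone E :=
          AddSubmonoid.subset_closure (Or.inr ⟨x, _, _, h1, Or.inr rfl⟩)
        have := add_mem h2 (hof (compl x))
        rwa [show FreeAbelianGroup.of (1 : E) - (FreeAbelianGroup.of x +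
          FreeAbelianGroup.of (compl x)) + FreeAbelianGroup.of (compl x) =
          FreeAbelianGroup.of 1 - FreeAbelianGroup.of x by abel] at this
      | neg x _ =>
        refine ⟨0, ?_⟩
        rw [zero_smul, map_neg, neg_nonpos]
        exact hpos _ (hof x)
      | add x y hx hy =>
        obtain ⟨n, hn⟩ := hx
        obtain ⟨m, hm⟩ := hy
        exact ⟨n + m, by rw [add_smul, map_add]; exact add_le_add hn hm⟩ }

/-- The class `[x]` of `x : E` in the universal group of `E`. -/
def cls {E : EA.{u}} (x : E) : universalGroup E :=
  (QuotientAddGroup.mk' (nulls E) (FreeAbelianGroup.of x) : FreeAbelianGroup E ⧸ nulls E)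

theorem nonneg_iff {E : EA.{u}} (z : FreeAbelianGroup E ⧸ nulls E) :
    @LE.le (universalGroup E) _ 0 z ↔ z ∈ cone E :=
  iff_of_eq (congrArg (· ∈ cone E) (sub_zero z))

theorem cls_nonneg {E : EA.{u}} (x : E) : 0 ≤ cls x :=
  (nonneg_iff _).2 ⟨_, AddSubmonoid.subset_closure (Or.inl ⟨x, rfl⟩), rfl⟩

theorem cls_add {E : EA.{u}} {a b c : E} (h : osum a b = some c) : cls a + cls b = cls c := by
  have h1 : FreeAbelianGroup.of a + FreeAbelianGroup.of b - FreeAbelianGroup.of c ∈ nulls E :=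
    ⟨AddSubmonoid.subset_closure (Or.inr ⟨a, b, c, h, Or.inl rfl⟩), by
      rw [neg_sub]
      exact AddSubmonoid.subset_closure (Or.inr ⟨a, b, c, h, Or.inr rfl⟩)⟩
  rw [← sub_eq_zero]
  exact (QuotientAddGroup.eq_zero_iff _).2 h1

/-- The map `x ↦ [x]` as a morphism `E ⟶ Γ(Gr(E))`. -/
noncomputable def toUniversalGroup (E : EA.{u}) : E ⟶ intervalFunctor.obj (universalGroup E) := show Hom _ _ from
  { toFun := fun x => ⟨cls x, cls_nonneg x, by
      rw [show (universalGroup E).unit = cls (1 : E) from rfl,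
        ← cls_add ((osum_eq_one_iff x _).2 rfl)]
      exact le_add_of_nonneg_right (cls_nonneg _)⟩
    map_osum' := fun a b c h => POGu.Interval.osum_eq_some.2 (cls_add h)
    map_one' := rfl }

theorem universalGroup_hom_ext {E : EA.{u}} {A : POGu.{u}} {f g : universalGroup E ⟶ A}
    (h : ∀ x : E, f (cls x) = g (cls x)) : f = g := by
  refine POGu.Hom.ext (QuotientAddGroup.addMonoidHom_ext _ (FreeAbelianGroup.lift_ext _ _ ?_))
  exact h

/-- The morphism out of the universal group induced by a morphism `E ⟶ Γ(A, u)`. -/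
noncomputable def universalGroupLift {E : EA.{u}} {A : POGu.{u}} (f : E ⟶ intervalFunctor.obj A) : universalGroup E ⟶ A :=
  let g : FreeAbelianGroup E →+ A := FreeAbelianGroup.lift fun x => (f x).val
  have hg : ∀ z ∈ preCone E, 0 ≤ g z := fun z hz => by
    refine AddSubmonoid.closure_induction (motive := fun z _ => 0 ≤ g z) ?_ ?_ ?_ hz
    · rintro _ (⟨x, rfl⟩ | ⟨a, b, c, h, rfl | rfl⟩)
      · simpa [g] using (f x).nonneg
      · have := POGu.Interval.osum_eq_some.1 (isAdd f _ _ _ h)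
        simp [g, this]
      · have := POGu.Interval.osum_eq_some.1 (isAdd f _ _ _ h)
        simp [g, this]
    · rw [map_zero]
    · intro x y _ _ hx hy
      rw [map_add]; exact add_nonneg hx hy
  show POGu.Hom _ _ from
  { toAddMonoidHom := QuotientAddGroup.lift (nulls E) g fun z hz => by
      have h1 := hg _ hz.1
      have h2 := hg _ hz.2
      rw [map_neg, neg_nonneg] at h2
      exact le_antisymm h2 h1
    map_nonneg' := fun x hx => by
      obtain ⟨z, hz, rfl⟩ := (nonneg_iff x).1 hx
      exact hg z hz
    map_unit' := by
      have : g (FreeAbelianGroup.of 1) = A.unit := by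
        simp only [g, FreeAbelianGroup.lift_apply_of, map_one]; rfl
      exact this }

@[simp]
theorem universalGroupLift_cls {E : EA.{u}} {A : POGu.{u}} (f : E ⟶ intervalFunctor.obj A) (x : E) :
    universalGroupLift f (cls x) = (f x).val :=
  FreeAbelianGroup.lift_apply_of _ _

/-- Universal property of the universal group. -/
theorem existsUnique_universalGroupLift {E : EA.{u}} {A : POGu.{u}} (f : E ⟶ intervalFunctor.obj A) :
    ∃! g : universalGroup E ⟶ A, toUniversalGroup E ≫ intervalFunctor.map g = f := by
  refine ⟨universalGroupLift f, hom_ext fun x => POGu.Interval.ext (universalGroupLift_cls f x),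
    fun g hg => universalGroup_hom_ext fun x => ?_⟩
  rw [universalGroupLift_cls, ← hg]
  rfl

end EA

/-- The universal group functor `Gr : EA ⥤ POG_u`. -/
noncomputable def Gr : EA.{u} ⥤ POGu.{u} where
  obj E := E.universalGroup
  map {_ F} f := EA.universalGroupLift (f ≫ F.toUniversalGroup)
  map_id E := EA.universalGroup_hom_ext fun x => EA.universalGroupLift_cls _ x
  map_comp f g := EA.universalGroup_hom_ext fun x => by
    refine (EA.universalGroupLift_cls _ x).trans (Eq.symm ?_)
    exact (congrArg (EA.universalGroupLift (g ≫ EA.toUniversalGroup _))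
      (EA.universalGroupLift_cls (f ≫ EA.toUniversalGroup _) x)).trans
        (EA.universalGroupLift_cls (g ≫ EA.toUniversalGroup _) (f x))

open MonoidalCategory

/-!
The functor `Gr` is strong monoidal because both tensor products classify bihomomorphisms and a
map on an effect algebra that is additive and positive extends uniquely to its universal group.

The map `[x ⊗ y] ↦ [x] ⊗ [y]` comes from the bihomomorphism `(x, y) ↦ [x] ⊗ [y]` from `E × F` to
`Γ(Gr(E) ⊗ Gr(F))` (`comparisonInv`). For its inverse, `(x, y) ↦ [x ⊗ y]` has to be extended to a
biadditive map `Gr(E) × Gr(F) → Gr(E ⊗ F)`, although for fixed `x` the map `y ↦ [x ⊗ y]` does not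
preserve the unit, so that the universal property of `Gr` does not apply directly. What is true is
that it is additive and positive, hence extends to a group homomorphism; and the elements of the
free group on `E` that vanish in `Gr(E)` act by zero, since they and their negatives act positively
on `Gr(F)`, which is generated by positive elements (`extendBiadd`).

All maps involved are determined by their values on tensors of classes `[x]`, so naturality and
coherence are checked there. The unit isomorphism and its uniqueness come from `(ℤ, 1)` being
initial in `POG_u`, together with the two-element effect algebra being initial in `EA`.
-/

/-! ### Extension of additive maps to the universal group -/

namespace EA

open EffectAlgebra

theorem cls_induction {E : EA.{u}} {P : universalGroup E → Prop} (hcls : ∀ x : E, P (cls x))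
    (hadd : ∀ a b, P a → P b → P (a + b)) (hneg : ∀ a, P a → P (-a)) (a : universalGroup E) :
    P a := by
  obtain ⟨z, rfl⟩ := QuotientAddGroup.mk'_surjective _ a
  induction z using FreeAbelianGroup.induction_on with
  | zero =>
    have h := hadd _ _ (hcls 0) (hneg _ (hcls 0))
    rwa [add_neg_cancel] at h
  | of x => exact hcls x
  | neg x h => exact hneg _ h
  | add x y hx hy => exact hadd _ _ hx hy

theorem addMonoidHom_ext {E : EA.{u}} {M : Type*} [AddCommGroup M] {f g : universalGroup E →+ M}
    (h : ∀ x : E, f (cls x) = g (cls x)) : f = g :=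
  DFunLike.ext _ _ fun a => cls_induction (P := fun a => f a = g a) h
    (fun a b ha hb => by rw [map_add, map_add, ha, hb]) (fun a ha => by rw [map_neg, map_neg, ha]) a

theorem nonneg_induction {E : EA.{u}} {P : universalGroup E → Prop} (hcls : ∀ x : E, P (cls x))
    (h0 : P 0) (hadd : ∀ a b, P a → P b → P (a + b)) {a : universalGroup E} (ha : 0 ≤ a) : P a := by
  obtain ⟨z, hz, rfl⟩ := (nonneg_iff a).1 ha
  refine AddSubmonoid.closure_induction
    (motive := fun z _ => P (QuotientAddGroup.mk' (nulls E) z)) ?_ h0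
    (fun x y _ _ hx hy => hadd _ _ hx hy) hz
  rintro _ (⟨x, rfl⟩ | ⟨a, b, c, h, rfl | rfl⟩)
  · exact hcls x
  · have h1 : cls a + cls b - cls c = 0 := by rw [cls_add h, sub_self]
    change P (cls a + cls b - cls c)
    rwa [h1]
  · have h1 : cls c - (cls a + cls b) = 0 := by rw [cls_add h, sub_self]
    change P (cls c - (cls a + cls b))
    rwa [h1]

theorem lift_mem_of_mem_preCone {E : EA.{u}} {M : Type*} [AddCommGroup M] (C : AddSubmonoid M)
    {f : E → M} (hadd : ∀ a b c, osum a b = some c → f a + f b = f c) (hf : ∀ x, f x ∈ C)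
    {z : FreeAbelianGroup E} (hz : z ∈ preCone E) : FreeAbelianGroup.lift f z ∈ C := by
  refine (AddSubmonoid.closure_le (S := C.comap (FreeAbelianGroup.lift f))).2 ?_ hz
  rintro _ (⟨x, rfl⟩ | ⟨a, b, c, h, rfl | rfl⟩)
  · simpa using hf x
  · simp [hadd a b c h]
  · simp [hadd a b c h]

/-- The extension to `Gr(E)` of a map that preserves orthosums and takes values in a submonoid `C`
with `C ∩ -C = 0`. The map need not preserve any unit. -/
def extend {E : EA.{u}} {M : Type*} [AddCommGroup M] (C : AddSubmonoid M)
    (hC : ∀ m ∈ C, -m ∈ C → m = 0) (f : E → M)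
    (hadd : ∀ a b c, osum a b = some c → f a + f b = f c) (hf : ∀ x, f x ∈ C) :
    universalGroup E →+ M :=
  QuotientAddGroup.lift (nulls E) (FreeAbelianGroup.lift f) fun z hz =>
    hC _ (lift_mem_of_mem_preCone C hadd hf hz.1) (by
      rw [← map_neg]
      exact lift_mem_of_mem_preCone C hadd hf hz.2)

@[simp]
theorem extend_cls {E : EA.{u}} {M : Type*} [AddCommGroup M] (C : AddSubmonoid M)
    (hC : ∀ m ∈ C, -m ∈ C → m = 0) (f : E → M)
    (hadd : ∀ a b c, osum a b = some c → f a + f b = f c) (hf : ∀ x, f x ∈ C) (x : E) :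
    extend C hC f hadd hf (cls x) = f x :=
  FreeAbelianGroup.lift_apply_of _ _

/-- The homomorphisms from `Gr(F)` that are positive on the classes `[y]`. -/
def positiveHoms (F : EA.{u}) (A : POGu.{u}) : AddSubmonoid (universalGroup F →+ A) where
  carrier := {f | ∀ y : F, 0 ≤ f (cls y)}
  zero_mem' _ := le_rfl
  add_mem' hf hg y := add_nonneg (hf y) (hg y)

/-- As `Gr(F)` is generated by positive elements, a homomorphism that is both positive and negative
vanishes. -/
theorem eq_zero_of_mem_positiveHoms {F : EA.{u}} {A : POGu.{u}} (f : universalGroup F →+ A)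
    (h : f ∈ positiveHoms F A) (h' : -f ∈ positiveHoms F A) : f = 0 :=
  addMonoidHom_ext fun y => le_antisymm (neg_nonneg.1 (h' y)) (h y)

/-- The extension to `Gr(E) × Gr(F)` of a positive map on `E × F` that preserves orthosums in each
variable. -/
def extendBiadd {E F : EA.{u}} {A : POGu.{u}} (β : E → F → A)
    (left : ∀ a b c y, osum a b = some c → β a y + β b y = β c y)
    (right : ∀ x a b c, osum a b = some c → β x a + β x b = β x c)
    (nonneg : ∀ x y, 0 ≤ β x y) : universalGroup E →+ universalGroup F →+ A :=
  extend (positiveHoms F A) eq_zero_of_mem_positiveHoms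
    (fun x => extend (AddSubmonoid.nonneg A) (fun _ h h' => le_antisymm (neg_nonneg.1 h') h)
      (β x) (right x) (nonneg x))
    (fun a b c h => addMonoidHom_ext fun y =>
      (congrArg₂ (· + ·) (extend_cls _ _ _ _ _ y) (extend_cls _ _ _ _ _ y)).trans
        ((left a b c y h).trans (extend_cls _ _ _ _ _ y).symm))
    (fun x y => (nonneg x y).trans_eq (extend_cls _ _ _ _ _ y).symm)

@[simp]
theorem extendBiadd_cls {E F : EA.{u}} {A : POGu.{u}} (β : E → F → A)
    (left : ∀ a b c y, osum a b = some c → β a y + β b y = β c y)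
    (right : ∀ x a b c, osum a b = some c → β x a + β x b = β x c)
    (nonneg : ∀ x y, 0 ≤ β x y) (x : E) (y : F) :
    extendBiadd β left right nonneg (cls x) (cls y) = β x y :=
  (DFunLike.congr_fun (extend_cls _ _ _ _ _ x) (cls y)).trans (extend_cls _ _ _ _ _ y)

theorem extendBiadd_nonneg {E F : EA.{u}} {A : POGu.{u}} (β : E → F → A)
    (left : ∀ a b c y, osum a b = some c → β a y + β b y = β c y)
    (right : ∀ x a b c, osum a b = some c → β x a + β x b = β x c)
    (nonneg : ∀ x y, 0 ≤ β x y) {a : universalGroup E} {b : universalGroup F} (ha : 0 ≤ a)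
    (hb : 0 ≤ b) : 0 ≤ extendBiadd β left right nonneg a b := by
  refine nonneg_induction (P := fun a => 0 ≤ extendBiadd β left right nonneg a b) (fun x => ?_)
    (by simp) (fun a a' h h' => by simpa using add_nonneg h h') ha
  refine nonneg_induction (P := fun b => 0 ≤ extendBiadd β left right nonneg (cls x) b)
    (fun y => ?_) (by simp) (fun b b' h h' => by simpa using add_nonneg h h') hb
  simpa using nonneg x y

/-! ### The comparison isomorphism -/

theorem universalGroup_tensor_hom_ext {E F : EA.{u}} {A : POGu.{u}}
    {f g : POGu.tensor (universalGroup E) (universalGroup F) ⟶ A}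
    (h : ∀ (x : E) (y : F), f (POGu.tmul (cls x) (cls y)) = g (POGu.tmul (cls x) (cls y))) :
    f = g := by
  have key : (POGu.tmulHom _ _).compr₂ (POGu.Hom.toAddMonoidHom f) =
      (POGu.tmulHom _ _).compr₂ (POGu.Hom.toAddMonoidHom g) :=
    addMonoidHom_ext fun x => addMonoidHom_ext fun y => h x y
  exact POGu.tensor_hom_ext fun a b => DFunLike.congr_fun (DFunLike.congr_fun key a) b

theorem universalGroup_tensor_hom_ext₃ {E F G : EA.{u}} {A : POGu.{u}}
    {f g : POGu.tensor (POGu.tensor (universalGroup E) (universalGroup F)) (universalGroup G) ⟶ A}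
    (h : ∀ (x : E) (y : F) (z : G), f (POGu.tmul (POGu.tmul (cls x) (cls y)) (cls z)) =
      g (POGu.tmul (POGu.tmul (cls x) (cls y)) (cls z))) :
    f = g := by
  let T (k : POGu.tensor (POGu.tensor (universalGroup E) (universalGroup F)) (universalGroup G) ⟶ A) :
      universalGroup E →+ universalGroup F →+ universalGroup G →+ A :=
    AddMonoidHom.compr₂ (POGu.tmulHom _ _)
      ((POGu.tmulHom _ _).compr₂ (POGu.Hom.toAddMonoidHom k))
  have key : T f = T g :=
    addMonoidHom_ext fun x => addMonoidHom_ext fun y => addMonoidHom_ext fun z => h x y z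
  exact POGu.tensor_hom_ext₃ fun a b c =>
    DFunLike.congr_fun (DFunLike.congr_fun (DFunLike.congr_fun key a) b) c

/-- The biadditive map `([x], [y]) ↦ [x ⊗ y]`. -/
noncomputable def comparisonAdd (E F : EA.{u}) :
    universalGroup E →+ universalGroup F →+ universalGroup (tensor E F) :=
  extendBiadd (fun x y => cls (tmul x y))
    (fun _ _ _ y h => cls_add ((tmul_isBihom E F).left y _ _ _ h))
    (fun x _ _ _ h => cls_add ((tmul_isBihom E F).right x _ _ _ h))
    (fun _ _ => cls_nonneg _)

theorem comparisonAdd_cls {E F : EA.{u}} (x : E) (y : F) :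
    comparisonAdd E F (cls x) (cls y) = cls (tmul x y) :=
  extendBiadd_cls (fun x y => cls (tmul x y)) _ _ _ x y

/-- The morphism `Gr(E) ⊗ Gr(F) ⟶ Gr(E ⊗ F)`, `[x] ⊗ [y] ↦ [x ⊗ y]`. -/
noncomputable def comparison (E F : EA.{u}) :
    POGu.tensor (universalGroup E) (universalGroup F) ⟶ universalGroup (tensor E F) :=
  POGu.ofAdd (POGu.liftAdd (comparisonAdd E F))
    (fun _ _ ha hb => extendBiadd_nonneg _ _ _ _ ha hb) (comparisonAdd_cls 1 1)

@[simp]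
theorem comparison_tmul {E F : EA.{u}} (x : E) (y : F) :
    comparison E F (POGu.tmul (cls x) (cls y)) = cls (tmul x y) :=
  comparisonAdd_cls x y

theorem tmul_cls_le_unit {E F : EA.{u}} (x : E) (y : F) :
    POGu.tmul (cls x) (cls y) ≤ (POGu.tensor (universalGroup E) (universalGroup F)).unit := by
  -- `u ⊗ v = [x] ⊗ [y] + [x] ⊗ [y'] + [x'] ⊗ v`
  have h1 : cls x + cls (compl x) = cls 1 := cls_add ((osum_eq_one_iff x _).2 rfl)
  have h2 : cls y + cls (compl y) = cls 1 := cls_add ((osum_eq_one_iff y _).2 rfl)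
  change _ ≤ POGu.tmul (cls (1 : E)) (cls (1 : F))
  rw [← h1, POGu.add_tmul]
  refine le_add_of_le_of_nonneg ?_ (POGu.tmul_nonneg (cls_nonneg _) (cls_nonneg _))
  rw [← h2, POGu.tmul_add]
  exact le_add_of_nonneg_right (POGu.tmul_nonneg (cls_nonneg _) (cls_nonneg _))

/-- The bihomomorphism `(x, y) ↦ [x] ⊗ [y]` with values in `Γ(Gr(E) ⊗ Gr(F))`. -/
noncomputable def tmulCls (E F : EA.{u}) (x : E) (y : F) :
    intervalFunctor.obj (POGu.tensor (universalGroup E) (universalGroup F)) :=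
  show POGu.Interval _ from ⟨POGu.tmul (cls x) (cls y),
    POGu.tmul_nonneg (cls_nonneg x) (cls_nonneg y), tmul_cls_le_unit x y⟩

theorem tmulCls_isBihom (E F : EA.{u}) : IsBihom (tmulCls E F) where
  left y _ _ _ h := POGu.Interval.osum_eq_some.2
    ((POGu.add_tmul _ _ _).symm.trans (congrArg (POGu.tmul · (cls y)) (cls_add h)))
  right x _ _ _ h := POGu.Interval.osum_eq_some.2
    ((POGu.tmul_add _ _ _).symm.trans (congrArg (POGu.tmul (cls x)) (cls_add h)))
  map_one := rfl

/-- The morphism `Gr(E ⊗ F) ⟶ Gr(E) ⊗ Gr(F)`, `[x ⊗ y] ↦ [x] ⊗ [y]`. -/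
noncomputable def comparisonInv (E F : EA.{u}) :
    universalGroup (tensor E F) ⟶ POGu.tensor (universalGroup E) (universalGroup F) :=
  universalGroupLift (lift (tmulCls E F) (tmulCls_isBihom E F))

@[simp]
theorem comparisonInv_cls {E F : EA.{u}} (x : E) (y : F) :
    comparisonInv E F (cls (tmul x y)) = POGu.tmul (cls x) (cls y) :=
  (universalGroupLift_cls _ _).trans
    (congrArg POGu.Interval.val (lift_tmul _ (tmulCls_isBihom E F) x y))

/-- Morphisms out of `Gr(E ⊗ F)` are determined by their values at the classes `[x ⊗ y]`. -/
theorem universalGroup_hom_ext_tmul {E F : EA.{u}} {A : POGu.{u}}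
    {f g : universalGroup (tensor E F) ⟶ A}
    (h : ∀ (x : E) (y : F), f (cls (tmul x y)) = g (cls (tmul x y))) : f = g := by
  have key : toUniversalGroup _ ≫ intervalFunctor.map f =
      toUniversalGroup _ ≫ intervalFunctor.map g :=
    tensor_hom_ext fun x y => POGu.Interval.ext (h x y)
  exact universalGroup_hom_ext fun p =>
    congrArg POGu.Interval.val (ConcreteCategory.congr_hom key p)

/-- The isomorphism `Gr(E) ⊗ Gr(F) ≅ Gr(E ⊗ F)`, `[x] ⊗ [y] ↦ [x ⊗ y]`. -/
noncomputable def comparisonIso (E F : EA.{u}) :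
    POGu.tensor (universalGroup E) (universalGroup F) ≅ universalGroup (tensor E F) where
  hom := comparison E F
  inv := comparisonInv E F
  hom_inv_id := universalGroup_tensor_hom_ext fun x y => by
    rw [ConcreteCategory.comp_apply, comparison_tmul, comparisonInv_cls]; rfl
  inv_hom_id := universalGroup_hom_ext_tmul fun x y => by
    rw [ConcreteCategory.comp_apply, comparisonInv_cls, comparison_tmul]; rfl

end EA

/-! ### The unit isomorphism -/

namespace POGu

/-- The morphism `n ↦ n • u` from `(ℤ, 1)` to `(A, u)`. -/
noncomputable def fromInt (A : POGu.{u}) : int.{u} ⟶ A := show Hom _ _ from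
  { toAddMonoidHom := AddMonoidHom.mk' (fun n => n.down • A.unit)
      fun n m => add_smul n.down m.down A.unit
    map_nonneg' := fun _ hn => zsmul_nonneg A.unit_nonneg hn
    map_unit' := one_smul ℤ A.unit }

theorem int_hom_eq {A : POGu.{u}} (f g : int.{u} ⟶ A) : f = g := by
  have key (f : int.{u} ⟶ A) (n : int.{u}) : f n = n.down • A.unit := by
    have hn : n = n.down • int.{u}.unit := ULift.ext _ _ (mul_one n.down).symm
    rw [hn, map_zsmul, map_unit, ← hn]
  exact hom_ext fun n => (key f n).trans (key g n).symm

end POGu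

namespace EA

open EffectAlgebra

/-- The morphism from the two-element effect algebra to `E`. -/
def fromTwo (E : EA.{u}) : two.{u} ⟶ E := show Hom _ _ from
  ⟨fun n => act n 1, act_isAdd_left 1, rfl⟩

theorem two_hom_eq {E : EA.{u}} (f g : two.{u} ⟶ E) : f = g := by
  refine hom_ext ?_
  rintro ⟨_ | _⟩
  · exact (isAdd f).map_zero.trans (isAdd g).map_zero.symm
  · exact (map_one f).trans (map_one g).symm

/-- The isomorphism `(ℤ, 1) ≅ Gr(2)`. -/
noncomputable def unitIso : POGu.int.{u} ≅ universalGroup two.{u} where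
  hom := POGu.fromInt _
  inv := universalGroupLift (fromTwo _)
  hom_inv_id := POGu.int_hom_eq _ _
  inv_hom_id := universalGroup_hom_ext fun x => congrArg POGu.Interval.val
    (ConcreteCategory.congr_hom (two_hom_eq
      (toUniversalGroup two ≫ intervalFunctor.map (universalGroupLift (fromTwo _) ≫ POGu.fromInt _))
      (toUniversalGroup two ≫ intervalFunctor.map (𝟙 _))) x)

end EA

/-! ### The monoidal structure of `Gr` -/

theorem Gr_map_cls {E F : EA.{u}} (f : E ⟶ F) (x : E) : Gr.map f (EA.cls x) = EA.cls (f x) :=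
  EA.universalGroupLift_cls _ x

/-- The strong monoidal structure of `Gr`. -/
noncomputable def grCoreMonoidal : Gr.{u}.CoreMonoidal where
  εIso := EA.unitIso
  μIso := EA.comparisonIso
  μIso_hom_natural_left {X Y} f Z := EA.universalGroup_tensor_hom_ext fun x z => by
    change EA.comparison Y Z (POGu.tmul (Gr.map f (EA.cls x)) (EA.cls z)) =
      Gr.map (EA.tensorMap f (𝟙 Z)) (EA.comparison X Z (POGu.tmul (EA.cls x) (EA.cls z)))
    rw [Gr_map_cls, EA.comparison_tmul, EA.comparison_tmul, Gr_map_cls, EA.tensorMap_tmul]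
    rfl
  μIso_hom_natural_right {X Y} Z f := EA.universalGroup_tensor_hom_ext fun z x => by
    change EA.comparison Z Y (POGu.tmul (EA.cls z) (Gr.map f (EA.cls x))) =
      Gr.map (EA.tensorMap (𝟙 Z) f) (EA.comparison Z X (POGu.tmul (EA.cls z) (EA.cls x)))
    rw [Gr_map_cls, EA.comparison_tmul, EA.comparison_tmul, Gr_map_cls, EA.tensorMap_tmul]
    rfl
  associativity X Y Z := EA.universalGroup_tensor_hom_ext₃ fun x y z => by
    change Gr.map (EA.assocHom X Y Z) (EA.comparison (EA.tensor X Y) Z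
        (POGu.tmul (EA.comparison X Y (POGu.tmul (EA.cls x) (EA.cls y))) (EA.cls z))) =
      EA.comparison X (EA.tensor Y Z)
        (POGu.tmul (EA.cls x) (EA.comparison Y Z (POGu.tmul (EA.cls y) (EA.cls z))))
    rw [EA.comparison_tmul, EA.comparison_tmul, Gr_map_cls, EA.assocHom_tmul,
      EA.comparison_tmul, EA.comparison_tmul]
  -- After composing with the inverse unitor of `POG_u`, both sides start at `Gr(X)`.
  left_unitality X := by
    rw [← cancel_epi (λ_ (Gr.obj X)).inv, Iso.inv_hom_id]
    refine EA.universalGroup_hom_ext fun x => ?_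
    change EA.cls x = Gr.map (EA.leftUnitor X).hom (EA.comparison EA.two X
      (POGu.tmul (POGu.fromInt (EA.universalGroup EA.two) POGu.int.unit) (EA.cls x)))
    rw [POGu.map_unit]
    change _ = Gr.map (EA.leftUnitor X).hom
      (EA.comparison EA.two X (POGu.tmul (EA.cls 1) (EA.cls x)))
    rw [EA.comparison_tmul, Gr_map_cls]
    exact congrArg EA.cls (ConcreteCategory.congr_hom (EA.leftUnitor X).inv_hom_id x).symm
  right_unitality X := by
    rw [← cancel_epi (ρ_ (Gr.obj X)).inv, Iso.inv_hom_id]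
    refine EA.universalGroup_hom_ext fun x => ?_
    change EA.cls x = Gr.map (EA.rightUnitor X).hom (EA.comparison X EA.two
      (POGu.tmul (EA.cls x) (POGu.fromInt (EA.universalGroup EA.two) POGu.int.unit)))
    rw [POGu.map_unit]
    change _ = Gr.map (EA.rightUnitor X).hom
      (EA.comparison X EA.two (POGu.tmul (EA.cls x) (EA.cls 1)))
    rw [EA.comparison_tmul, Gr_map_cls]
    exact congrArg EA.cls (ConcreteCategory.congr_hom (EA.rightUnitor X).inv_hom_id x).symm

theorem mainTheorem1 :
    ∃ M : Gr.{u}.Monoidal,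
      (∀ e : 𝟙_ POGu.{u} ⟶ Gr.{u}.obj (𝟙_ EA.{u}), e = M.ε) ∧
      ∀ (E F : EA.{u}) (x : E) (y : F),
        M.μ E F (POGu.tmul (EA.cls x) (EA.cls y)) = EA.cls (EA.tmul x y) :=
  ⟨grCoreMonoidal.toMonoidal, fun e => POGu.int_hom_eq e _, fun _ _ => EA.comparison_tmul⟩
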